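/- Let $R$ be a unital associative ring. A right Gabriel filter on a ring $A$ is a nonempty set $\mathcal F$ of right ideals of $A$ such that (i) if $I\in\mathcal F$ and $a\in A$, then $(a:I)=\{b\in A\mid ab\in I\}\in\mathcal F$; (ii) if $I\in\mathcal F$ and $J$ is a right ideal with $(a:J)\in\mathcal F$ for all $a\in I$, then $J\in\mathcal F$. Left Gabriel filters are defined dually. A left (right) module is torsion for a left (right) Gabriel filter if the annihilator of each of its elements belongs to the filter; every module $M$ has a largest torsion submodule. Regard $R$-bimodules as right modules over $R\otimes_{\mathbb Z}R^{op}$ via $m\cdot(r\otimes s)=smr$. The symmetric filter ${}_l\mathcal F_r$ induced by a left Gabriel filter $\mathcal F_l$ and a right Gabriel filter $\mathcal F_r$ on $R$ is the Gabriel filter of all right ideals $K$ of $R\otimes_{\mathbb Z}R^{op}$ such that the bimodule $(R\otimes_{\mathbb Z} R^{op})/K$ is torsion both for $\mathcal F_l$ as a left $R$-module and for $\mathcal F_r$ as a right $R$-module. For an $R$-bimodule $M$, let ${}_l\mathcal T_r(M)$ be its torsion sub-bimodule for ${}_l\mathcal F_r$ (the set of elements whose left and right annihilators belong to $\mathcal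 F_l$ and $\mathcal F_r$ respectively). The symmetric module of quotients is the $R$-bimodule $${}_lM_r=\varinjlim_{K\in{}_l\mathcal F_r}\operatorname{Hom}_{R\otimes R^{op}}\bigl(K,\,M/{}_l\mathcal T_r(M)\bigr),$$ with action $(f\cdot a)(b)=f(ab)$ for $a\in R\otimes_{\mathbb Z}R^{op}$, and $q_M:M\to{}_lM_r$ is the canonical map sending $m$ to the class of $a\mapsto (m+{}_l\mathcal T_r(M))\cdot a$. A higher derivation on $R$ is a family $\Delta=\{\delta_n\}_{n\ge 0}$ of additive maps $R\to R$ with $\delta_0=\mathrm{id}$ and $\delta_n(rs)=\sum_{i=0}^n\delta_i(r)\delta_{n-i}(s)$ for all $n$, $r$, $s$. It induces additive maps $\overline{\delta}_n$ on $R\otimes_{\mathbb Z}R^{op}$, $\overline{\delta}_n(r\otimes s)=\sum_{i=0}^n\delta_i(r)\otimes\delta_{n-i}(s)$. A $\Delta$-higher derivation on an $R$-bimodule $M$ is a family $D=\{d_n\}_{n\ge 0}$ of additive maps $M\to M$ with $d_0=\mathrm{id}$, $d_n(xr)=\sum_{i=0}^n d_i(x)\delta_{n-i}(r)$ and $d_n(rx)=\sum_{i=0}^n\delta_i(r)d_{n-i}(x)$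 for all $n$, $x\in M$, $r\in R$. An extension of $D$ to ${}_lM_r$ is a $\Delta$-higher derivation $D'=\{d'_n\}$ on ${}_lM_r$ with $d'_nq_M=q_Md_n$ for all $n$. 1. Every symmetric filter ${}_l\mathcal F_r$ is higher derivation invariant: for every higher derivation $\Delta$ on $R$, every $K\in{}_l\mathcal F_r$ and every $n$ there is $J\in{}_l\mathcal F_r$ such that $\overline{\delta}_i(J)\subseteq K$ for all $i\le n$. 2. For every symmetric filter ${}_l\mathcal F_r$, every higher derivation $\Delta$ on $R$ and every $R$-bimodule $M$, every $\Delta$-higher derivation $D$ on $M$ has a unique extension to ${}_lM_r$. 3. Let ${}_l\mathcal F_r^1\subseteq{}_l\mathcal F_r^2$ be symmetric filters on $R$, each induced by a left and a right Gabriel filter, let $\Delta$ be a higher derivation on $R$, $M$ an $R$-bimodule, and $D$ a $\Delta$-higher derivation on $M$. Let $q_1:M\to{}_lM_r^1$ and $q_2:M\to{}_lM_r^2$ be the canonical maps into the two symmetric modules of quotients, and let $q_{12}:{}_lM_r^1\to{}_lM_r^2$ be the map induced by the inclusion of the filters. Then the extensions $\{d^1_n\}$ and $\{d^2_n\}$ of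 $D$ to ${}_lM_r^1$ and ${}_lM_r^2$ agree: $q_{12}q_1=q_2$, $d_n^jq_j=q_jd_n$ for $j=1,2$, and $q_{12}d^1_n=d^2_nq_{12}$ for all $n$. -/

import Mathlib

open MulOpposite TensorProduct

universe u v

/-! Right modules over a ring `A` are modules over `Aᵐᵒᵖ`; the right action `m · a` is `op a • m`.
Right ideals of `A` are elements of `Submodule Aᵐᵒᵖ A`, left ideals are elements of `Ideal A`. -/

section Residuals

variable {A : Type u} [Ring A] {M : Type v} [AddCommGroup M]

/-- The right ideal `(m : N) = {a | m · a ∈ N}` for a submodule `N` of a right module. -/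
def rightResidual [Module Aᵐᵒᵖ M] (m : M) (N : Submodule Aᵐᵒᵖ M) : Submodule Aᵐᵒᵖ A where
  carrier := {a | op a • m ∈ N}
  add_mem' {a b} ha hb := by
    simpa only [Set.mem_ofPred_eq, op_add, add_smul] using N.add_mem ha hb
  zero_mem' := by simp
  smul_mem' c a ha := by
    have h : op (c • a) = c * op a := by
      rw [← op_unop c, op_smul_eq_mul, op_mul]
    simpa only [Set.mem_ofPred_eq, h, mul_smul] using N.smul_mem c ha

/-- The left ideal `{a | a · m ∈ N}` for a submodule `N` of a left module. -/
def leftResidual [Module A M] (m : M) (N : Submodule A M) : Ideal A where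
  carrier := {a | a • m ∈ N}
  add_mem' {a b} ha hb := by
    simpa only [Set.mem_ofPred_eq, add_smul] using N.add_mem ha hb
  zero_mem' := by simp
  smul_mem' c a ha := by
    simpa only [Set.mem_ofPred_eq, smul_eq_mul, mul_smul] using N.smul_mem c ha

@[simp] theorem mem_rightResidual [Module Aᵐᵒᵖ M] {m : M} {N : Submodule Aᵐᵒᵖ M} {a : A} :
    a ∈ rightResidual m N ↔ op a • m ∈ N := Iff.rfl

@[simp] theorem mem_leftResidual [Module A M] {m : M} {N : Submodule A M} {a : A} :
    a ∈ leftResidual m N ↔ a • m ∈ N := Iff.rfl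

end Residuals

/-- A Gabriel filter of right ideals of `A`. -/
structure RightGabrielFilter (A : Type u) [Ring A] where
  ideals : Set (Submodule Aᵐᵒᵖ A)
  nonempty : ideals.Nonempty
  residual_mem : ∀ I ∈ ideals, ∀ a : A, rightResidual a I ∈ ideals
  mem_of_residual : ∀ I ∈ ideals, ∀ J : Submodule Aᵐᵒᵖ A,
    (∀ a ∈ I, rightResidual a J ∈ ideals) → J ∈ ideals

/-- A Gabriel filter of left ideals of `A`. -/
structure LeftGabrielFilter (A : Type u) [Ring A] where
  ideals : Set (Ideal A)
  nonempty : ideals.Nonempty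
  residual_mem : ∀ I ∈ ideals, ∀ a : A, leftResidual a I ∈ ideals
  mem_of_residual : ∀ I ∈ ideals, ∀ J : Ideal A,
    (∀ a ∈ I, leftResidual a J ∈ ideals) → J ∈ ideals

namespace LeftGabrielFilter

variable {A : Type u} [Ring A] (F : LeftGabrielFilter A)

theorem top_mem : ⊤ ∈ F.ideals := by
  obtain ⟨I, hI⟩ := F.nonempty
  have h : leftResidual (0 : A) I = ⊤ := by ext; simp
  exact h ▸ F.residual_mem I hI 0

theorem mem_of_le {I J : Ideal A} (hI : I ∈ F.ideals) (h : I ≤ J) : J ∈ F.ideals := by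
  refine F.mem_of_residual I hI J fun a ha => ?_
  have : leftResidual a J = ⊤ := by
    ext b; simpa using J.smul_mem b (h ha)
  exact this ▸ F.top_mem

theorem inf_mem {I J : Ideal A} (hI : I ∈ F.ideals) (hJ : J ∈ F.ideals) : I ⊓ J ∈ F.ideals := by
  refine F.mem_of_residual I hI _ fun a ha => F.mem_of_le (F.residual_mem J hJ a) fun b hb => ?_
  exact ⟨I.smul_mem b ha, hb⟩

end LeftGabrielFilter

namespace RightGabrielFilter

variable {A : Type u} [Ring A] (F : RightGabrielFilter A)

theorem top_mem : ⊤ ∈ F.ideals := by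
  obtain ⟨I, hI⟩ := F.nonempty
  have h : rightResidual (0 : A) I = ⊤ := by ext; simp
  exact h ▸ F.residual_mem I hI 0

theorem mem_of_le {I J : Submodule Aᵐᵒᵖ A} (hI : I ∈ F.ideals) (h : I ≤ J) : J ∈ F.ideals := by
  refine F.mem_of_residual I hI J fun a ha => ?_
  have : rightResidual a J = ⊤ := by
    ext b; simpa using J.smul_mem (op b) (h ha)
  exact this ▸ F.top_mem

theorem inf_mem {I J : Submodule Aᵐᵒᵖ A} (hI : I ∈ F.ideals) (hJ : J ∈ F.ideals) :
    I ⊓ J ∈ F.ideals := by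
  refine F.mem_of_residual I hI _ fun a ha => F.mem_of_le (F.residual_mem J hJ a) fun b hb => ?_
  exact ⟨I.smul_mem (op b) ha, hb⟩

variable (M : Type v) [AddCommGroup M] [Module Aᵐᵒᵖ M]

/-- The torsion submodule: the elements whose annihilator `(m : 0)` is in the filter. -/
def torsion : Submodule Aᵐᵒᵖ M where
  carrier := {m | rightResidual m ⊥ ∈ F.ideals}
  add_mem' {x y} hx hy := by
    refine F.mem_of_le (F.inf_mem hx hy) ?_
    rintro a ⟨h1, h2⟩
    have h1' : op a • x = 0 := h1
    have h2' : op a • y = 0 := h2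
    simp [h1', h2']
  zero_mem' := by
    refine F.mem_of_le F.top_mem ?_
    intro a _
    simp
  smul_mem' c x hx := by
    refine F.mem_of_le (F.residual_mem _ hx (unop c)) ?_
    intro a ha
    have h : op (unop c * a) • x = 0 := ha
    rw [op_mul, op_unop, mul_smul] at h
    simpa using h

/-- The ideals of the filter, ordered by reverse inclusion. -/
abbrev Index : Type u := (F.ideals : Set (Submodule Aᵐᵒᵖ A))ᵒᵈ

/-- The right ideal of an index. -/
abbrev idealOf (i : F.Index) : Submodule Aᵐᵒᵖ A := (OrderDual.ofDual i).1

/-- The index of a right ideal in the filter. -/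
abbrev index (I : Submodule Aᵐᵒᵖ A) (hI : I ∈ F.ideals) : F.Index := OrderDual.toDual ⟨I, hI⟩

instance : Nonempty F.Index := ⟨F.index ⊤ F.top_mem⟩

instance : IsDirectedOrder F.Index where
  directed i j := ⟨F.index _ (F.inf_mem i.2 j.2), fun _ h => h.1, fun _ h => h.2⟩

variable {F} in
theorem index_le {i j : F.Index} (h : F.idealOf j ≤ F.idealOf i) : i ≤ j := h

variable {F} in
theorem idealOf_le {i j : F.Index} (h : i ≤ j) : F.idealOf j ≤ F.idealOf i := h

/-- `Hom(I, M/t(M))`. -/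
abbrev HomOn (i : F.Index) : Type (max u v) := F.idealOf i →ₗ[Aᵐᵒᵖ] (M ⧸ F.torsion M)

/-- Restriction of homomorphisms to a smaller ideal. -/
def restrict (i j : F.Index) (h : i ≤ j) : F.HomOn M i →+ F.HomOn M j where
  toFun f := f.comp (Submodule.inclusion (p := F.idealOf j) (p' := F.idealOf i) h)
  map_zero' := rfl
  map_add' _ _ := rfl

instance : DirectedSystem (F.HomOn M) (F.restrict M · · ·) where
  map_self _ _ := rfl
  map_map _ _ _ _ _ _ := rfl

/-- The module of quotients `lim_{I ∈ F} Hom(I, M/t(M))`. -/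
def ModuleOfQuotients : Type (max u v) := DirectLimit (F.HomOn M) (F.restrict M)

noncomputable instance instAddCommGroupQuotients : AddCommGroup (F.ModuleOfQuotients M) :=
  inferInstanceAs (AddCommGroup (DirectLimit (F.HomOn M) (F.restrict M)))

variable {M}

/-- The class in the module of quotients of a homomorphism `I → M/t(M)`. -/
def ofHom (i : F.Index) (f : F.HomOn M i) : F.ModuleOfQuotients M :=
  (⟦⟨i, f⟩⟧ : DirectLimit (F.HomOn M) (F.restrict M))

theorem ofHom_eq_ofHom {i j : F.Index} (k : F.Index) (hi : i ≤ k) (hj : j ≤ k) {f : F.HomOn M i}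
    {g : F.HomOn M j} (h : ∀ x (hx : x ∈ F.idealOf k), f ⟨x, hi hx⟩ = g ⟨x, hj hx⟩) :
    F.ofHom i f = F.ofHom j g :=
  Quotient.sound ⟨k, hi, hj, LinearMap.ext fun x => h x.1 x.2⟩

theorem ofHom_add (i : F.Index) (f g : F.HomOn M i) : F.ofHom i (f + g) = F.ofHom i f + F.ofHom i g :=
  (DirectLimit.add_def (f := F.restrict M) i f g).symm

theorem ofHom_surj (x : F.ModuleOfQuotients M) : ∃ i f, x = F.ofHom i f :=
  DirectLimit.exists_eq_mk (F.restrict M) x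

theorem ofHom_surj₂ (x y : F.ModuleOfQuotients M) : ∃ i f g, x = F.ofHom i f ∧ y = F.ofHom i g :=
  DirectLimit.exists_eq_mk₂ (F.restrict M) x y

/-- For `f : I → M/t(M)`, the homomorphism `f · a : (a : I) → M/t(M)`, `b ↦ f (a b)`. -/
def homSMul (a : A) (i : F.Index) (f : F.HomOn M i) :
    F.HomOn M (F.index (rightResidual a (F.idealOf i)) (F.residual_mem _ i.2 a)) where
  toFun b := f ⟨a * b.1, b.2⟩
  map_add' b c := by
    rw [← map_add]; congr 1; exact Subtype.ext (mul_add a b.1 c.1)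
  map_smul' c b := by
    rw [RingHom.id_apply, ← map_smul]; congr 1
    exact Subtype.ext (mul_assoc a b.1 (unop c)).symm

/-- The right action of `A` on the module of quotients, `[f] · a = [f · a]`. -/
noncomputable instance instSMulQuotients : SMul Aᵐᵒᵖ (F.ModuleOfQuotients M) where
  smul c x := DirectLimit.lift (F.restrict M)
    (fun i f => F.ofHom _ (F.homSMul (unop c) i f))
    (fun i j h f => by
      refine F.ofHom_eq_ofHom (F.index _ (F.residual_mem _ j.2 (unop c)))
        (index_le fun b hb => ?_) le_rfl fun _ _ => rfl
      change unop c * b ∈ F.idealOf i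
      exact idealOf_le h hb) x

theorem smul_ofHom (c : Aᵐᵒᵖ) (i : F.Index) (f : F.HomOn M i) :
    c • F.ofHom i f = F.ofHom _ (F.homSMul (unop c) i f) := rfl

noncomputable instance instModuleQuotients : Module Aᵐᵒᵖ (F.ModuleOfQuotients M) where
  one_smul x := by
    obtain ⟨i, f, rfl⟩ := F.ofHom_surj x
    rw [smul_ofHom]
    refine F.ofHom_eq_ofHom i (index_le fun b hb => ?_) le_rfl fun b hb => ?_
    · change (1 : A) * b ∈ F.idealOf i
      rwa [one_mul]
    · change f ⟨(1 : A) * b, _⟩ = _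
      congr 1
      exact Subtype.ext (one_mul b)
  mul_smul c d x := by
    obtain ⟨i, f, rfl⟩ := F.ofHom_surj x
    simp only [smul_ofHom]
    refine F.ofHom_eq_ofHom _ (index_le fun b hb => ?_) le_rfl fun b hb => ?_
    · change unop d * unop c * b ∈ F.idealOf i
      rw [mul_assoc]; exact hb
    · change f ⟨unop d * unop c * b, _⟩ = f ⟨unop d * (unop c * b), _⟩
      congr 1
      exact Subtype.ext (mul_assoc _ _ _)
  smul_zero c := by
    have h : F.ofHom (Classical.arbitrary F.Index) 0 = (0 : F.ModuleOfQuotients M) :=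
      (DirectLimit.zero_def (f := F.restrict M) _).symm
    rw [← h, smul_ofHom]
    refine F.ofHom_eq_ofHom (F.index _ (F.inf_mem (F.residual_mem _ (Classical.arbitrary F.Index).2
      (unop c)) (Classical.arbitrary F.Index).2)) (index_le inf_le_left) (index_le inf_le_right)
      fun _ _ => rfl
  smul_add c x y := by
    obtain ⟨i, f, g, rfl, rfl⟩ := F.ofHom_surj₂ x y
    rw [← ofHom_add, smul_ofHom, smul_ofHom, smul_ofHom, ← ofHom_add]
    rfl
  add_smul c d x := by
    obtain ⟨i, f, rfl⟩ := F.ofHom_surj x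
    let k : F.Index := F.index _ (F.inf_mem (F.residual_mem _ i.2 (unop c))
      (F.residual_mem _ i.2 (unop d)))
    rw [smul_ofHom, smul_ofHom, smul_ofHom,
      F.ofHom_eq_ofHom (f := F.homSMul (unop c) i f)
        (g := F.restrict M _ k (index_le inf_le_left) (F.homSMul (unop c) i f)) k (index_le inf_le_left) le_rfl
        fun _ _ => rfl,
      F.ofHom_eq_ofHom (f := F.homSMul (unop d) i f)
        (g := F.restrict M _ k (index_le inf_le_right) (F.homSMul (unop d) i f)) k (index_le inf_le_right) le_rfl
        fun _ _ => rfl, ← ofHom_add]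
    refine F.ofHom_eq_ofHom k (index_le fun b hb => ?_) le_rfl fun b hb => ?_
    · change (unop c + unop d) * b ∈ F.idealOf i
      rw [add_mul]; exact (F.idealOf i).add_mem hb.1 hb.2
    · change f ⟨(unop c + unop d) * b, _⟩ = f ⟨unop c * b, hb.1⟩ + f ⟨unop d * b, hb.2⟩
      rw [← map_add]
      congr 1
      exact Subtype.ext (add_mul _ _ _)
  zero_smul x := by
    obtain ⟨i, f, rfl⟩ := F.ofHom_surj x
    have h : F.ofHom i 0 = (0 : F.ModuleOfQuotients M) :=
      (DirectLimit.zero_def (f := F.restrict M) _).symm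
    rw [← h, smul_ofHom]
    refine F.ofHom_eq_ofHom i (index_le fun b _ => ?_) le_rfl fun b hb => ?_
    · change (0 : A) * b ∈ F.idealOf i
      rw [zero_mul]; exact zero_mem _
    · change f ⟨(0 : A) * b, _⟩ = 0
      rw [← map_zero f]
      congr 1
      exact Subtype.ext (zero_mul b)

/-- The homomorphism `A → M/t(M)`, `a ↦ [m] · a`. -/
def homOfElem (m : M) : F.HomOn M (F.index ⊤ F.top_mem) where
  toFun a := op a.1 • (F.torsion M).mkQ m
  map_add' a b := by
    change op (a.1 + b.1) • (F.torsion M).mkQ m = _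
    rw [op_add, add_smul]
  map_smul' c a := by
    change op (a.1 * unop c) • (F.torsion M).mkQ m = _
    rw [op_mul, op_unop, mul_smul, RingHom.id_apply]

variable (M) in
/-- The canonical map `q_M : M → M_F`. -/
noncomputable def toQuotients : M →ₗ[Aᵐᵒᵖ] F.ModuleOfQuotients M where
  toFun m := F.ofHom _ (F.homOfElem m)
  map_add' x y := by
    rw [← ofHom_add]
    congr 1
    ext a
    change op a.1 • (F.torsion M).mkQ (x + y) =
      op a.1 • (F.torsion M).mkQ x + op a.1 • (F.torsion M).mkQ y
    rw [map_add, smul_add]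
  map_smul' c x := by
    rw [RingHom.id_apply, smul_ofHom]
    refine F.ofHom_eq_ofHom (F.index ⊤ F.top_mem) le_rfl (index_le fun b _ => ?_) fun b hb => ?_
    · change unop c * b ∈ (⊤ : Submodule Aᵐᵒᵖ A)
      trivial
    change op b • (F.torsion M).mkQ (c • x) = op (unop c * b) • (F.torsion M).mkQ x
    rw [map_smul, op_mul, op_unop, mul_smul]

theorem torsion_mono {F G : RightGabrielFilter A} (h : F.ideals ⊆ G.ideals) :
    F.torsion M ≤ G.torsion M := fun _ hx => h hx

/-- For `F ⊆ G`, the map `Hom(I, M/t_F(M)) → Hom(I, M/t_G(M))`. -/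
def homChange {F G : RightGabrielFilter A} (h : F.ideals ⊆ G.ideals) (i : F.Index)
    (f : F.HomOn M i) : G.HomOn M (G.index (F.idealOf i) (h i.2)) :=
  (Submodule.factor (torsion_mono (M := M) h)).comp f

variable (M) in
/-- For `F ⊆ G`, the induced map `q_{FG} : M_F → M_G`. -/
noncomputable def quotientsMap {F G : RightGabrielFilter A} (h : F.ideals ⊆ G.ideals) :
    F.ModuleOfQuotients M →ₗ[Aᵐᵒᵖ] G.ModuleOfQuotients M where
  toFun := DirectLimit.lift (F.restrict M) (fun i f => G.ofHom _ (homChange h i f))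
    (fun _ j hij _ => G.ofHom_eq_ofHom (G.index _ (h j.2)) hij le_rfl fun _ _ => rfl)
  map_add' x y := by
    obtain ⟨i, f, g, rfl, rfl⟩ := F.ofHom_surj₂ x y
    rw [← ofHom_add]
    change G.ofHom _ (homChange h i (f + g)) = G.ofHom _ (homChange h i f) + G.ofHom _ (homChange h i g)
    rw [← ofHom_add]
    congr 1
    exact LinearMap.comp_add _ _ _
  map_smul' c x := by
    obtain ⟨i, f, rfl⟩ := F.ofHom_surj x
    rfl

end RightGabrielFilter

section Bimodules

variable (R : Type u) [Ring R]

/-- The ring `R ⊗_ℤ R^op`. -/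
abbrev Env : Type u := R ⊗[ℤ] Rᵐᵒᵖ

/-- The ring homomorphism `R^op → (R ⊗ R^op)^op` of `r ↦ r ⊗ 1`; it gives the right `R`-action on a
right `R ⊗ R^op`-module. -/
noncomputable def envRight : Rᵐᵒᵖ →+* (Env R)ᵐᵒᵖ :=
  RingHom.op (Algebra.TensorProduct.includeLeftRingHom : R →+* Env R)

/-- The ring homomorphism `R → (R ⊗ R^op)^op` of `s ↦ 1 ⊗ s`; it gives the left `R`-action on a
right `R ⊗ R^op`-module. -/
noncomputable def envLeft : R →+* (Env R)ᵐᵒᵖ :=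
  (RingHom.op (Algebra.TensorProduct.includeRight : Rᵐᵒᵖ →ₐ[ℤ] Env R).toRingHom).comp
    (RingEquiv.opOp R).toRingHom

theorem envRight_op (r : R) : envRight R (op r) = op (r ⊗ₜ[ℤ] (1 : Rᵐᵒᵖ)) := rfl

theorem envLeft_apply (s : R) : envLeft R s = op ((1 : R) ⊗ₜ[ℤ] op s) := rfl

theorem envLeft_commute_envRight (s : R) (r : Rᵐᵒᵖ) :
    envLeft R s * envRight R r = envRight R r * envLeft R s := by
  rw [← op_unop r, envRight_op, envLeft_apply, ← op_mul, ← op_mul]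
  simp

section Action

variable (M : Type v) [AddCommGroup M] [Module R M] [Module Rᵐᵒᵖ M] [SMulCommClass R Rᵐᵒᵖ M]

/-- The ring homomorphism `(R ⊗ R^op)^op → End(M)` of an `R`-bimodule `M`, given by
`m · (r ⊗ s) = s m r`. -/
noncomputable def envAction : (Env R)ᵐᵒᵖ →+* Module.End ℤ M :=
  (RingEquiv.opOp (Module.End ℤ M)).symm.toRingHom.comp
    (RingHom.op (Algebra.TensorProduct.lift
      ((RingHom.op (Module.toModuleEnd ℤ M : Rᵐᵒᵖ →+* Module.End ℤ M)).comp
        (RingEquiv.opOp R).toRingHom).toIntAlgHom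
      (RingHom.op (Module.toModuleEnd ℤ M : R →+* Module.End ℤ M)).toIntAlgHom
      (fun r s => unop_injective (LinearMap.ext fun m =>
        smul_comm (unop s) (op r) m))).toRingHom)

theorem envAction_tmul (r s : R) (m : M) :
    envAction R M (op (r ⊗ₜ[ℤ] op s)) m = s • op r • m := rfl

/-- An `R`-bimodule as a right `R ⊗ R^op`-module, `m · (r ⊗ s) = s m r`. -/
noncomputable abbrev bimoduleToRight : Module (Env R)ᵐᵒᵖ M := Module.compHom M (envAction R M)

end Action

variable {R}

/-- For a right ideal `K` of `R ⊗ R^op` and `x ∈ R ⊗ R^op`, the right ideal `{r | x · (r ⊗ 1) ∈ K}`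
of `R`: the annihilator of the class of `x` in the right `R`-module `(R ⊗ R^op)/K`. -/
noncomputable def envRightAnn (K : Submodule (Env R)ᵐᵒᵖ (Env R)) (x : Env R) : Submodule Rᵐᵒᵖ R :=
  letI : Module Rᵐᵒᵖ (Env R) := Module.compHom (Env R) (envRight R)
  rightResidual x
    ({ K with smul_mem' := fun r _ h => K.smul_mem (envRight R r) h } : Submodule Rᵐᵒᵖ (Env R))

/-- For a right ideal `K` of `R ⊗ R^op` and `x ∈ R ⊗ R^op`, the left ideal `{s | x · (1 ⊗ s) ∈ K}`
of `R`: the annihilator of the class of `x` in the left `R`-module `(R ⊗ R^op)/K`. -/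
noncomputable def envLeftAnn (K : Submodule (Env R)ᵐᵒᵖ (Env R)) (x : Env R) : Ideal R :=
  letI : Module R (Env R) := Module.compHom (Env R) (envLeft R)
  leftResidual x
    ({ K with smul_mem' := fun r _ h => K.smul_mem (envLeft R r) h } : Submodule R (Env R))

theorem mem_envRightAnn {K : Submodule (Env R)ᵐᵒᵖ (Env R)} {x : Env R} {r : R} :
    r ∈ envRightAnn K x ↔ x * (r ⊗ₜ[ℤ] (1 : Rᵐᵒᵖ)) ∈ K := Iff.rfl

theorem mem_envLeftAnn {K : Submodule (Env R)ᵐᵒᵖ (Env R)} {x : Env R} {s : R} :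
    s ∈ envLeftAnn K x ↔ x * ((1 : R) ⊗ₜ[ℤ] op s) ∈ K := Iff.rfl

/-- The symmetric Gabriel filter induced by a left and a right Gabriel filter on `R`: the right
ideals `K` of `R ⊗ R^op` such that the bimodule `(R ⊗ R^op)/K` is torsion as a left and as a right
`R`-module. -/
def symmetricFilter (Fl : LeftGabrielFilter R) (Fr : RightGabrielFilter R) :
    RightGabrielFilter (Env R) where
  ideals := {K | ∀ x : Env R, envLeftAnn K x ∈ Fl.ideals ∧ envRightAnn K x ∈ Fr.ideals}
  nonempty := by
    refine ⟨⊤, fun x => ⟨?_, ?_⟩⟩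
    · convert Fl.top_mem using 1
      ext; simp [mem_envLeftAnn]
    · convert Fr.top_mem using 1
      ext; simp [mem_envRightAnn]
  residual_mem K hK a x := by
    obtain ⟨h1, h2⟩ := hK (a * x)
    refine ⟨?_, ?_⟩
    · convert h1 using 1
      ext s; simp [mem_envLeftAnn, mul_assoc]
    · convert h2 using 1
      ext s; simp [mem_envRightAnn, mul_assoc]
  mem_of_residual K hK L hL x := by
    refine ⟨Fl.mem_of_residual _ (hK x).1 _ fun s hs => ?_,
      Fr.mem_of_residual _ (hK x).2 _ fun r hr => ?_⟩
    · convert (hL (x * ((1 : R) ⊗ₜ[ℤ] op s)) hs 1).1 using 1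
      ext t
      simp [mem_envLeftAnn, mul_assoc]
    · convert (hL (x * (r ⊗ₜ[ℤ] (1 : Rᵐᵒᵖ))) hr 1).2 using 1
      ext t
      simp [mem_envRightAnn, mul_assoc]

/-- A symmetric filter consists of the right ideals of `R ⊗ R^op` that contain some
`J ⊗ R^op + R ⊗ I` with `I` in the left filter and `J` in the right filter. -/
theorem mem_symmetricFilter_iff (Fl : LeftGabrielFilter R) (Fr : RightGabrielFilter R)
    (K : Submodule (Env R)ᵐᵒᵖ (Env R)) :
    K ∈ (symmetricFilter Fl Fr).ideals ↔ ∃ I ∈ Fl.ideals, ∃ J ∈ Fr.ideals,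
      (∀ s ∈ I, (1 : R) ⊗ₜ[ℤ] op s ∈ K) ∧ (∀ r ∈ J, r ⊗ₜ[ℤ] (1 : Rᵐᵒᵖ) ∈ K) := by
  constructor
  · intro h
    refine ⟨_, (h 1).1, _, (h 1).2, fun s hs => ?_, fun r hr => ?_⟩
    · simpa [mem_envLeftAnn] using hs
    · simpa [mem_envRightAnn] using hr
  · rintro ⟨I, hI, J, hJ, h1, h2⟩ x
    induction x using TensorProduct.induction_on with
    | zero =>
      exact ⟨Fl.mem_of_le Fl.top_mem fun s _ => by simp [mem_envLeftAnn],
        Fr.mem_of_le Fr.top_mem fun r _ => by simp [mem_envRightAnn]⟩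
    | add x y hx hy =>
      refine ⟨Fl.mem_of_le (Fl.inf_mem hx.1 hy.1) fun s hs => ?_,
        Fr.mem_of_le (Fr.inf_mem hx.2 hy.2) fun r hr => ?_⟩
      · rw [mem_envLeftAnn, add_mul]
        exact K.add_mem hs.1 hs.2
      · rw [mem_envRightAnn, add_mul]
        exact K.add_mem hr.1 hr.2
    | tmul a b =>
      refine ⟨Fl.mem_of_le (Fl.residual_mem I hI (unop b)) fun s hs => ?_,
        Fr.mem_of_le (Fr.residual_mem J hJ a) fun r hr => ?_⟩
      · have h := K.smul_mem (op (a ⊗ₜ[ℤ] (1 : Rᵐᵒᵖ))) (h1 (s * unop b) hs)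
        rw [op_smul_eq_mul, Algebra.TensorProduct.tmul_mul_tmul] at h
        rw [mem_envLeftAnn, Algebra.TensorProduct.tmul_mul_tmul]
        simpa using h
      · have h := K.smul_mem (op ((1 : R) ⊗ₜ[ℤ] b)) (h2 (a * r) hr)
        rw [op_smul_eq_mul, Algebra.TensorProduct.tmul_mul_tmul] at h
        rw [mem_envRightAnn, Algebra.TensorProduct.tmul_mul_tmul]
        simpa using h

section SymmetricQuotients

variable (Fl : LeftGabrielFilter R) (Fr : RightGabrielFilter R)
variable (M : Type v) [AddCommGroup M] [Module R M] [Module Rᵐᵒᵖ M] [SMulCommClass R Rᵐᵒᵖ M]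

/-- The torsion submodule of a bimodule for the symmetric filter is the intersection of its left and
right torsion submodules. -/
theorem mem_symmetric_torsion_iff (m : M) :
    m ∈ @RightGabrielFilter.torsion (Env R) _ (symmetricFilter Fl Fr) M _ (bimoduleToRight R M) ↔
      leftResidual m (⊥ : Submodule R M) ∈ Fl.ideals ∧
        rightResidual m (⊥ : Submodule Rᵐᵒᵖ M) ∈ Fr.ideals := by
  refine (mem_symmetricFilter_iff Fl Fr _).trans ?_
  have h1 : ∀ s : R, envAction R M (op ((1 : R) ⊗ₜ[ℤ] op s)) m = s • m := fun s => by
    rw [envAction_tmul, op_one, one_smul]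
  have h2 : ∀ r : R, envAction R M (op (r ⊗ₜ[ℤ] (1 : Rᵐᵒᵖ))) m = op r • m := fun r => by
    rw [← op_one, envAction_tmul, one_smul]
  constructor
  · rintro ⟨I, hI, J, hJ, hs, hr⟩
    exact ⟨Fl.mem_of_le hI fun s h => (h1 s).symm.trans (hs s h),
      Fr.mem_of_le hJ fun r h => (h2 r).symm.trans (hr r h)⟩
  · rintro ⟨hl, hr⟩
    exact ⟨_, hl, _, hr, fun s h => (h1 s).trans h, fun r h => (h2 r).trans h⟩

/-- The symmetric module of quotients
`lim_K Hom(K, M/t(M))`, `K` in the symmetric filter, `Hom` over `R ⊗ R^op`. -/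
def SymmetricQuotients : Type (max u v) :=
  @RightGabrielFilter.ModuleOfQuotients (Env R) _ (symmetricFilter Fl Fr) M _
    (bimoduleToRight R M)

noncomputable instance : AddCommGroup (SymmetricQuotients Fl Fr M) :=
  @RightGabrielFilter.instAddCommGroupQuotients (Env R) _ (symmetricFilter Fl Fr) M _
    (bimoduleToRight R M)

noncomputable instance : Module (Env R)ᵐᵒᵖ (SymmetricQuotients Fl Fr M) :=
  @RightGabrielFilter.instModuleQuotients (Env R) _ (symmetricFilter Fl Fr) M _
    (bimoduleToRight R M)

/-- The left `R`-action `s x = x · (1 ⊗ s)`. -/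
noncomputable instance : Module R (SymmetricQuotients Fl Fr M) :=
  Module.compHom _ (envLeft R)

/-- The right `R`-action `x r = x · (r ⊗ 1)`. -/
noncomputable instance : Module Rᵐᵒᵖ (SymmetricQuotients Fl Fr M) :=
  Module.compHom _ (envRight R)

instance : SMulCommClass R Rᵐᵒᵖ (SymmetricQuotients Fl Fr M) where
  smul_comm s r x := by
    change envLeft R s • envRight R r • x = envRight R r • envLeft R s • x
    rw [← mul_smul, ← mul_smul, envLeft_commute_envRight]

/-- The canonical map `q_M` from a bimodule to its symmetric module of quotients. -/
noncomputable def toSymmetricQuotients : M →+ SymmetricQuotients Fl Fr M :=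
  (@RightGabrielFilter.toQuotients (Env R) _ (symmetricFilter Fl Fr) M _
    (bimoduleToRight R M)).toAddMonoidHom

variable {Fl Fr} in
/-- The map between symmetric modules of quotients induced by an inclusion of symmetric filters. -/
noncomputable def symmetricQuotientsMap {Fl' : LeftGabrielFilter R} {Fr' : RightGabrielFilter R}
    (h : (symmetricFilter Fl Fr).ideals ⊆ (symmetricFilter Fl' Fr').ideals) :
    SymmetricQuotients Fl Fr M →+ SymmetricQuotients Fl' Fr' M :=
  (@RightGabrielFilter.quotientsMap (Env R) _ M _ (bimoduleToRight R M) _ _ h).toAddMonoidHom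

end SymmetricQuotients

end Bimodules

/-- A higher derivation `{δ_n}` on a ring. -/
structure HigherDerivation (R : Type u) [Ring R] where
  toFun : ℕ → R →+ R
  map_zero : toFun 0 = AddMonoidHom.id R
  map_mul : ∀ n r s, toFun n (r * s) =
    ∑ p ∈ Finset.HasAntidiagonal.antidiagonal n, toFun p.1 r * toFun p.2 s

namespace HigherDerivation

variable {R : Type u} [Ring R] (Δ : HigherDerivation R)

/-- The additive map on `R ⊗ R^op` with `r ⊗ s ↦ ∑ δ_i(r) ⊗ δ_{n-i}(s)`. -/
noncomputable def env (n : ℕ) : Env R →+ Env R :=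
  ∑ p ∈ Finset.HasAntidiagonal.antidiagonal n,
    (TensorProduct.map (Δ.toFun p.1).toIntLinearMap
      (AddMonoidHom.mulOp (Δ.toFun p.2)).toIntLinearMap).toAddMonoidHom

theorem env_tmul (n : ℕ) (r s : R) : Δ.env n (r ⊗ₜ[ℤ] op s) =
    ∑ p ∈ Finset.HasAntidiagonal.antidiagonal n, Δ.toFun p.1 r ⊗ₜ[ℤ] op (Δ.toFun p.2 s) :=
  AddMonoidHom.finsetSum_apply _ _ _

end HigherDerivation

/-- A filter of right ideals of `R ⊗ R^op` is invariant under a higher derivation `Δ` of `R` if for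
every `K` in it and every `n` there is `J` in it with `δ̄_i(J) ⊆ K` for all `i ≤ n`. -/
def RightGabrielFilter.IsInvariant {R : Type u} [Ring R] (F : RightGabrielFilter (Env R))
    (Δ : HigherDerivation R) : Prop :=
  ∀ K ∈ F.ideals, ∀ n : ℕ, ∃ J ∈ F.ideals, ∀ i ≤ n, ∀ x ∈ J, Δ.env i x ∈ K

/-- A `Δ`-higher derivation `{d_n}` on an `R`-bimodule. -/
structure BimoduleHigherDerivation {R : Type u} [Ring R] (Δ : HigherDerivation R) (M : Type v)
    [AddCommGroup M] [Module R M] [Module Rᵐᵒᵖ M] where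
  toFun : ℕ → M →+ M
  map_zero : toFun 0 = AddMonoidHom.id M
  map_smul_left : ∀ n (r : R) (x : M), toFun n (r • x) =
    ∑ p ∈ Finset.HasAntidiagonal.antidiagonal n, Δ.toFun p.1 r • toFun p.2 x
  map_smul_right : ∀ n (x : M) (r : R), toFun n (op r • x) =
    ∑ p ∈ Finset.HasAntidiagonal.antidiagonal n, op (Δ.toFun p.2 r) • toFun p.1 x

namespace BimoduleHigherDerivation

variable {R : Type u} [Ring R] {Δ : HigherDerivation R} {M : Type v} [AddCommGroup M] [Module R M]
  [Module Rᵐᵒᵖ M] [SMulCommClass R Rᵐᵒᵖ M]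

/-- `D'` is an extension of `D` to the symmetric module of quotients: `d'_n q_M = q_M d_n`. -/
def IsExtension {Fl : LeftGabrielFilter R} {Fr : RightGabrielFilter R}
    (D' : BimoduleHigherDerivation Δ (SymmetricQuotients Fl Fr M))
    (D : BimoduleHigherDerivation Δ M) : Prop :=
  ∀ n (m : M), D'.toFun n (toSymmetricQuotients Fl Fr M m) =
    toSymmetricQuotients Fl Fr M (D.toFun n m)

/-- The extensions `D₁` and `D₂` of `D` agree: with `q₁`, `q₂` the canonical maps and `q₁₂` the map
induced by the inclusion of filters, all faces of the prism
`q₁₂ q₁ = q₂`, `d_n q₁ = q₁ d_n`, `d_n q₂ = q₂ d_n`, `q₁₂ d_n = d_n q₁₂` commute. -/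
structure ExtensionsAgree {Fl₁ Fl₂ : LeftGabrielFilter R} {Fr₁ Fr₂ : RightGabrielFilter R}
    (h : (symmetricFilter Fl₁ Fr₁).ideals ⊆ (symmetricFilter Fl₂ Fr₂).ideals)
    (D : BimoduleHigherDerivation Δ M)
    (D₁ : BimoduleHigherDerivation Δ (SymmetricQuotients Fl₁ Fr₁ M))
    (D₂ : BimoduleHigherDerivation Δ (SymmetricQuotients Fl₂ Fr₂ M)) : Prop where
  triangle : ∀ m : M, symmetricQuotientsMap M h (toSymmetricQuotients Fl₁ Fr₁ M m) =
    toSymmetricQuotients Fl₂ Fr₂ M m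
  extends₁ : D₁.IsExtension D
  extends₂ : D₂.IsExtension D
  square : ∀ n x, symmetricQuotientsMap M h (D₁.toFun n x) =
    D₂.toFun n (symmetricQuotientsMap M h x)

end BimoduleHigherDerivation

/-! Nothing in the argument is special to symmetric filters: it works for any Gabriel filter F of
right ideals of any ring A with a higher derivation Δ. It is then applied to A = R ⊗ R^op, where δ̄
is again a higher derivation (`envHigherDerivation`) and a bimodule higher derivation is a
right-module one (`env_leibniz`).

Invariance (`comapIdeal_mem`): the right ideal {a | δ_i(a) ∈ I for i ≤ n} lies in F. In δ_{n+1}(ab)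
every term but δ_{n+1}(a)b has a factor δ_i(a) with i ≤ n, so axiom (ii) gives the passage from n to
n + 1.

Existence: regard Δ as the power series ∑ δ_n tⁿ over End(A). Its constant term is 1, so it has an
inverse ε, which is again a higher derivation (`inv`). The derivative of f : I → M/t(M) is the
conjugate ∑ d_i ∘ f ∘ ε_{n-i}, defined where ε_0, …, ε_n take values in I, an ideal of F by
invariance. It is A-linear because δ and ε cancel (`sum_map_inv_smul`); the Leibniz rule on classes
uses the cancellation in the other order (`onQuotients_smul_ofHom`).

Uniqueness and agreement (`compatible_of_compatible_on_range`): each x ∈ M_F is carried into q(M) by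
an ideal of F, and M_F is torsion-free. Expanding d_n(xa) by the Leibniz rule and inducting on n, a
higher derivation is determined by its values on q(M), also after composition with a linear map to a
torsion-free module. -/

section AntidiagonalSums

/-! ### Reindexing of convolution sums -/

open Finset

variable {N : Type*} [AddCommMonoid N]

theorem sum_antidiagonal_assoc (n : ℕ) (g : ℕ → ℕ → ℕ → N) :
    ∑ p ∈ antidiagonal n, ∑ q ∈ antidiagonal p.1, g q.1 q.2 p.2 =
      ∑ p ∈ antidiagonal n, ∑ q ∈ antidiagonal p.2, g p.1 q.1 q.2 := by
  rw [sum_sigma', sum_sigma']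
  refine sum_nbij' (fun x => ⟨(x.2.1, x.2.2 + x.1.2), (x.2.2, x.1.2)⟩)
    (fun x => ⟨(x.1.1 + x.2.1, x.2.2), (x.1.1, x.2.1)⟩) ?_ ?_ ?_ ?_ fun _ _ => rfl <;>
  · rintro ⟨⟨a, b⟩, c, d⟩ h
    simp only [mem_sigma, HasAntidiagonal.mem_antidiagonal] at h ⊢
    obtain ⟨h1, h2⟩ := h
    subst h1 h2
    simp [add_assoc]

theorem sum_antidiagonal_swap (n : ℕ) (g : ℕ → ℕ → N) :
    ∑ p ∈ antidiagonal n, g p.1 p.2 = ∑ p ∈ antidiagonal n, g p.2 p.1 :=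
  (Nat.sum_antidiagonal_swap (f := fun p => g p.1 p.2)).symm

theorem sum_antidiagonal_left_comm (n : ℕ) (g : ℕ → ℕ → ℕ → N) :
    ∑ p ∈ antidiagonal n, ∑ q ∈ antidiagonal p.2, g p.1 q.1 q.2 =
      ∑ p ∈ antidiagonal n, ∑ q ∈ antidiagonal p.2, g q.1 p.1 q.2 := by
  rw [← sum_antidiagonal_assoc n g, ← sum_antidiagonal_assoc n fun a b c => g b a c]
  exact sum_congr rfl fun p _ => sum_antidiagonal_swap p.1 fun a b => g a b p.2

/-- Exchanging the two middle indices brings each δ next to the ε that it is to cancel. -/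
theorem sum_antidiagonal_four_comm (n : ℕ) (g : ℕ → ℕ → ℕ → ℕ → N) :
    ∑ p ∈ antidiagonal n, ∑ q ∈ antidiagonal p.1, ∑ r ∈ antidiagonal p.2, g q.1 q.2 r.1 r.2 =
      ∑ p ∈ antidiagonal n, ∑ q ∈ antidiagonal p.1, ∑ r ∈ antidiagonal p.2,
        g q.1 r.1 q.2 r.2 := by
  rw [sum_antidiagonal_assoc n fun a b c => ∑ r ∈ antidiagonal c, g a b r.1 r.2,
    sum_antidiagonal_assoc n fun a b c => ∑ r ∈ antidiagonal c, g a r.1 b r.2]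
  exact sum_congr rfl fun p _ => sum_antidiagonal_left_comm p.2 (g p.1)

theorem sum_antidiagonal_of_ne_zero_eq_zero (n : ℕ) (g : ℕ → ℕ → N)
    (h : ∀ a b, b ≠ 0 → g a b = 0) : ∑ p ∈ antidiagonal n, g p.1 p.2 = g n 0 := by
  rw [sum_eq_single (n, 0)]
  · rintro ⟨a, b⟩ hab hne
    refine h a b fun hb => hne ?_
    simp only [HasAntidiagonal.mem_antidiagonal] at hab
    subst hb
    simpa using hab
  · intro hn
    simp at hn

end AntidiagonalSums

/-! ### The inverse of a higher derivation -/

namespace HigherDerivation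

open Finset

variable {A : Type u} [Ring A] (Δ : HigherDerivation A)

theorem zero_apply (a : A) : Δ.toFun 0 a = a := by
  rw [Δ.map_zero, AddMonoidHom.id_apply]

/-- In the expansion of δ_n(1 · 1) the middle terms vanish by induction, and the two end terms give
δ_n(1) = δ_n(1) + δ_n(1). -/
theorem map_one (n : ℕ) (hn : n ≠ 0) : Δ.toFun n 1 = 0 := by
  induction n using Nat.strong_induction_on with
  | _ n ih =>
    obtain ⟨m, rfl⟩ := Nat.exists_eq_succ_of_ne_zero hn
    have h := Δ.map_mul (m + 1) 1 1
    rw [mul_one, Nat.sum_antidiagonal_succ, sum_eq_single (m, 0)] at h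
    · simpa [Δ.zero_apply] using h
    · rintro ⟨a, b⟩ hab hne
      simp only [HasAntidiagonal.mem_antidiagonal] at hab
      have hb : b ≠ 0 := fun hb => hne (by subst hb; simpa using hab)
      rw [ih (a + 1) (by omega) (by omega), zero_mul]
    · intro hm
      simp at hm

/-- The higher derivation as a power series over the ring of additive endomorphisms. -/
noncomputable def series : PowerSeries (Module.End ℤ A) :=
  PowerSeries.mk fun n => (Δ.toFun n).toIntLinearMap

theorem constantCoeff_series :
    PowerSeries.constantCoeff Δ.series = ((1 : (Module.End ℤ A)ˣ) : Module.End ℤ A) := by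
  rw [← PowerSeries.coeff_zero_eq_constantCoeff_apply, series, PowerSeries.coeff_mk, Δ.map_zero]
  rfl

/-- The coefficients of the inverse of the power series of a higher derivation. -/
noncomputable def invFun (n : ℕ) : A →+ A :=
  (PowerSeries.coeff n (PowerSeries.invOfUnit Δ.series 1)).toAddMonoidHom

theorem sum_apply_invFun (n : ℕ) (a : A) :
    ∑ p ∈ antidiagonal n, Δ.toFun p.1 (Δ.invFun p.2 a) = if n = 0 then a else 0 := by
  have h := congrArg (PowerSeries.coeff n)
    (PowerSeries.mul_invOfUnit Δ.series 1 Δ.constantCoeff_series)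
  rw [PowerSeries.coeff_mul, PowerSeries.coeff_one] at h
  have h' := LinearMap.congr_fun h a
  rw [LinearMap.sum_apply] at h'
  simp only [series, PowerSeries.coeff_mk] at h'
  refine h'.trans ?_
  split_ifs <;> rfl

theorem sum_invFun_apply (n : ℕ) (a : A) :
    ∑ p ∈ antidiagonal n, Δ.invFun p.1 (Δ.toFun p.2 a) = if n = 0 then a else 0 := by
  have h := congrArg (PowerSeries.coeff n)
    (PowerSeries.invOfUnit_mul Δ.series 1 Δ.constantCoeff_series)
  rw [PowerSeries.coeff_mul, PowerSeries.coeff_one] at h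
  have h' := LinearMap.congr_fun h a
  rw [LinearMap.sum_apply] at h'
  simp only [series, PowerSeries.coeff_mk] at h'
  refine h'.trans ?_
  split_ifs <;> rfl

/-- A sequence is determined by its image under the power series of a higher derivation. -/
theorem eq_of_sum_eq {x y : ℕ → A}
    (h : ∀ n, ∑ p ∈ antidiagonal n, Δ.toFun p.1 (x p.2) = ∑ p ∈ antidiagonal n, Δ.toFun p.1 (y p.2))
    (n : ℕ) : x n = y n := by
  -- Convolution with ε on the left recovers the sequence from its image.
  have key : ∀ (z : ℕ → A), z n = ∑ p ∈ antidiagonal n, Δ.invFun p.1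
      (∑ q ∈ antidiagonal p.2, Δ.toFun q.1 (z q.2)) := fun z => by
    simp only [map_sum]
    rw [← sum_antidiagonal_assoc n fun a b c => Δ.invFun a (Δ.toFun b (z c))]
    simp only [sum_invFun_apply]
    rw [sum_antidiagonal_swap n fun a b => if a = 0 then z b else 0,
      sum_antidiagonal_of_ne_zero_eq_zero n fun a b => if b = 0 then z a else 0]
    · simp
    · intro a b hb
      simp [hb]
  rw [key x, key y]
  simp only [h]

/-- The inverse of a higher derivation. -/
noncomputable def inv : HigherDerivation A where
  toFun := Δ.invFun
  map_zero := by
    ext a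
    simpa [Δ.zero_apply] using Δ.sum_apply_invFun 0 a
  map_mul n r s := by
    -- The Leibniz rule for ε is tested after applying Δ: the left side becomes rs in degree 0, and
    -- the right side becomes the product of the convolutions ∑ δε(r) and ∑ δε(s).
    refine Δ.eq_of_sum_eq (x := fun n => Δ.invFun n (r * s))
      (y := fun n => ∑ p ∈ antidiagonal n, Δ.invFun p.1 r * Δ.invFun p.2 s) (fun n => ?_) n
    simp only [map_sum, Δ.map_mul]
    rw [Δ.sum_apply_invFun]
    have h := sum_antidiagonal_four_comm n fun a b c d =>
      Δ.toFun a (Δ.invFun c r) * Δ.toFun b (Δ.invFun d s)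
    simp only [← mul_sum, ← sum_mul, sum_apply_invFun] at h
    rw [sum_antidiagonal_of_ne_zero_eq_zero n fun a b =>
      (if a = 0 then r else 0) * (if b = 0 then s else 0)] at h
    · rw [sum_congr rfl fun p _ => sum_comm, h]
      by_cases hn : n = 0 <;> simp [hn]
    · intro a b hb
      simp [hb]

theorem sum_apply_inv (n : ℕ) (a : A) :
    ∑ p ∈ antidiagonal n, Δ.toFun p.1 (Δ.inv.toFun p.2 a) = if n = 0 then a else 0 :=
  Δ.sum_apply_invFun n a

theorem sum_inv_apply (n : ℕ) (a : A) :
    ∑ p ∈ antidiagonal n, Δ.inv.toFun p.1 (Δ.toFun p.2 a) = if n = 0 then a else 0 :=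
  Δ.sum_invFun_apply n a

end HigherDerivation

/-! ### Invariance of Gabriel filters -/

namespace HigherDerivation

open Finset

variable {A : Type u} [Ring A] (Δ : HigherDerivation A)

/-- The right ideal of the elements whose images under `δ_0, …, δ_n` are in the right ideal `I`. -/
def comapIdeal (I : Submodule Aᵐᵒᵖ A) (n : ℕ) : Submodule Aᵐᵒᵖ A where
  carrier := {a | ∀ i ≤ n, Δ.toFun i a ∈ I}
  add_mem' ha hb i hi := by
    rw [map_add]
    exact I.add_mem (ha i hi) (hb i hi)
  zero_mem' i _ := by
    rw [_root_.map_zero]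
    exact I.zero_mem
  smul_mem' c a ha i hi := by
    change Δ.toFun i (a * unop c) ∈ I
    rw [Δ.map_mul]
    refine I.sum_mem fun p hp => I.smul_mem (op (Δ.toFun p.2 (unop c))) (ha p.1 ?_)
    have := HasAntidiagonal.mem_antidiagonal.1 hp
    omega

theorem comapIdeal_le (I : Submodule Aᵐᵒᵖ A) (n : ℕ) : Δ.comapIdeal I n ≤ I := fun a ha => by
  simpa [Δ.zero_apply] using ha 0 (Nat.zero_le n)

theorem comapIdeal_mono {I J : Submodule Aᵐᵒᵖ A} (h : I ≤ J) (n : ℕ) :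
    Δ.comapIdeal I n ≤ Δ.comapIdeal J n := fun _ ha i hi => h (ha i hi)

theorem comapIdeal_mem (F : RightGabrielFilter A) {I : Submodule Aᵐᵒᵖ A} (hI : I ∈ F.ideals)
    (n : ℕ) : Δ.comapIdeal I n ∈ F.ideals := by
  induction n with
  | zero =>
    refine F.mem_of_le hI fun a ha i hi => ?_
    rw [Nat.le_zero.1 hi, Δ.zero_apply]
    exact ha
  | succ n ih =>
    -- For a in the ideal of level n, any b with δ_{n+1}(a)b ∈ I puts ab in the ideal of level n +
    -- 1: the other terms have a left factor δ_i(a) ∈ I, i ≤ n.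
    refine F.mem_of_residual _ ih _ fun a ha =>
      F.mem_of_le (F.residual_mem I hI (Δ.toFun (n + 1) a)) fun b hb i hi => ?_
    change Δ.toFun i (a * b) ∈ I
    rw [Δ.map_mul]
    refine I.sum_mem fun p hp => ?_
    have hp' := HasAntidiagonal.mem_antidiagonal.1 hp
    by_cases h : p.1 ≤ n
    · exact I.smul_mem (op (Δ.toFun p.2 b)) (ha p.1 h)
    · rw [show p.1 = n + 1 by omega, show p.2 = 0 by omega, Δ.zero_apply]
      exact hb

end HigherDerivation

/-- A family `{d_n}` of additive maps on a right module over a ring with a higher derivation, with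
`d_0 = id` and `d_n(m a) = ∑ d_i(m) δ_{n-i}(a)`. -/
structure IsRightHigherDerivation {A : Type u} [Ring A] (Δ : HigherDerivation A) {M : Type v}
    [AddCommGroup M] [Module Aᵐᵒᵖ M] (d : ℕ → M →+ M) : Prop where
  map_zero : d 0 = AddMonoidHom.id M
  map_smul : ∀ n (m : M) (a : A), d n (op a • m) =
    ∑ p ∈ Finset.HasAntidiagonal.antidiagonal n, op (Δ.toFun p.2 a) • d p.1 m

/-! ### Torsion-freeness of the module of quotients and comparison of higher derivations -/

namespace RightGabrielFilter

open Finset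

variable {A : Type u} [Ring A] (F : RightGabrielFilter A)
variable {M : Type v} [AddCommGroup M] [Module Aᵐᵒᵖ M]

theorem finset_inf_mem {ι : Type*} (s : Finset ι) (I : ι → Submodule Aᵐᵒᵖ A)
    (h : ∀ k ∈ s, I k ∈ F.ideals) : s.inf I ∈ F.ideals := by
  classical
  induction s using Finset.induction_on with
  | empty => simpa using F.top_mem
  | insert k s _ ih =>
    rw [Finset.inf_insert]
    exact F.inf_mem (h k (mem_insert_self k s)) (ih fun l hl => h l (mem_insert_of_mem hl))

theorem mem_torsion_of_smul_eq_zero {I : Submodule Aᵐᵒᵖ A} (hI : I ∈ F.ideals) {m : M}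
    (h : ∀ a ∈ I, op a • m = 0) : m ∈ F.torsion M :=
  F.mem_of_le hI fun a ha => by simpa using h a ha

/-- This is axiom (ii) applied to the annihilator of m; it makes M/t(M) torsion-free. -/
theorem mem_torsion_of_smul_mem {I : Submodule Aᵐᵒᵖ A} (hI : I ∈ F.ideals) {m : M}
    (h : ∀ a ∈ I, op a • m ∈ F.torsion M) : m ∈ F.torsion M := by
  refine F.mem_of_residual I hI _ fun a ha => F.mem_of_le (h a ha) fun b hb => ?_
  have hb' : op b • op a • m = 0 := hb
  change op (a * b) • m = 0
  rw [op_mul, mul_smul, hb']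

theorem quotient_eq_zero {I : Submodule Aᵐᵒᵖ A} (hI : I ∈ F.ideals) {x : M ⧸ F.torsion M}
    (h : ∀ a ∈ I, op a • x = 0) : x = 0 := by
  obtain ⟨m, rfl⟩ := (F.torsion M).mkQ_surjective x
  refine (Submodule.Quotient.mk_eq_zero _).2 (F.mem_torsion_of_smul_mem hI fun a ha => ?_)
  exact (Submodule.Quotient.mk_eq_zero _).1 (h a ha)

theorem ofHom_zero (i : F.Index) : F.ofHom i (0 : F.HomOn M i) = 0 :=
  (DirectLimit.zero_def (f := F.restrict M) i).symm

theorem exists_of_ofHom_eq_zero {i : F.Index} {f : F.HomOn M i} (h : F.ofHom i f = 0) :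
    ∃ k, ∃ hk : i ≤ k, ∀ x (hx : x ∈ F.idealOf k), f ⟨x, hk hx⟩ = 0 := by
  rw [← F.ofHom_zero i] at h
  obtain ⟨k, hk, _, e⟩ := Quotient.exact h
  exact ⟨k, hk, fun x hx => LinearMap.congr_fun e ⟨x, hx⟩⟩

/-- If [f] · a = 0, then f(a) is killed by an ideal of the filter, hence is 0 in the torsion-free
M/t(M). So f vanishes on the part of its domain inside I. -/
theorem moduleOfQuotients_eq_zero {I : Submodule Aᵐᵒᵖ A} (hI : I ∈ F.ideals)
    {y : F.ModuleOfQuotients M} (h : ∀ a ∈ I, op a • y = 0) : y = 0 := by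
  obtain ⟨i, f, rfl⟩ := F.ofHom_surj y
  rw [← F.ofHom_zero i]
  refine F.ofHom_eq_ofHom (F.index _ (F.inf_mem i.2 hI)) (index_le inf_le_left)
    (index_le inf_le_left) fun a ha => ?_
  have ha' := h a ha.2
  rw [smul_ofHom] at ha'
  obtain ⟨k, hk, e⟩ := F.exists_of_ofHom_eq_zero ha'
  refine F.quotient_eq_zero k.2 fun b hb => ?_
  rw [← map_smul]
  exact e b hb

theorem smul_ofHom_of_mem (i : F.Index) (f : F.HomOn M i) {a : A} (ha : a ∈ F.idealOf i) {m : M}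
    (hm : (F.torsion M).mkQ m = f ⟨a, ha⟩) : op a • F.ofHom i f = F.toQuotients M m := by
  rw [smul_ofHom]
  refine F.ofHom_eq_ofHom (F.index _ (F.residual_mem _ i.2 a)) le_rfl
    (index_le (i := F.index ⊤ F.top_mem) fun _ _ => trivial) fun b hb => ?_
  change f ⟨a * b, _⟩ = op b • (F.torsion M).mkQ m
  rw [hm, ← map_smul]
  rfl

/-- The domain of a representative f works, since [f] · a is the image of any lift of f(a). -/
theorem exists_smul_eq_toQuotients (x : F.ModuleOfQuotients M) :
    ∃ I ∈ F.ideals, ∀ a ∈ I, ∃ m, op a • x = F.toQuotients M m := by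
  obtain ⟨i, f, rfl⟩ := F.ofHom_surj x
  refine ⟨F.idealOf i, i.2, fun a ha => ?_⟩
  obtain ⟨m, hm⟩ := (F.torsion M).mkQ_surjective (f ⟨a, ha⟩)
  exact ⟨m, F.smul_ofHom_of_mem i f ha hm⟩

/-- Higher derivations on `M_F` and on an `F`-torsion-free module that are compatible with a linear
map on the image of `M` are compatible with it. -/
theorem compatible_of_compatible_on_range {Δ : HigherDerivation A} {X : Type*} [AddCommGroup X]
    [Module Aᵐᵒᵖ X]
    (hX : ∀ I ∈ F.ideals, ∀ y : X, (∀ a ∈ I, op a • y = 0) → y = 0)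
    (α : F.ModuleOfQuotients M →ₗ[Aᵐᵒᵖ] X)
    {d : ℕ → F.ModuleOfQuotients M →+ F.ModuleOfQuotients M} {e : ℕ → X →+ X}
    (hd : IsRightHigherDerivation Δ d) (he : IsRightHigherDerivation Δ e)
    (h : ∀ n m, α (d n (F.toQuotients M m)) = e n (α (F.toQuotients M m))) (n : ℕ)
    (x : F.ModuleOfQuotients M) : α (d n x) = e n (α x) := by
  induction n using Nat.strong_induction_on with
  | _ n ih =>
    obtain ⟨I, hI, hx⟩ := F.exists_smul_eq_toQuotients x
    refine sub_eq_zero.1 (hX I hI _ fun a ha => ?_)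
    obtain ⟨m, hm⟩ := hx a ha
    -- Both sides agree at xa ∈ q(M). After the Leibniz expansions the terms with i < n cancel by
    -- induction, leaving (α(d_n x) − e_n(α x)) · a = 0.
    have key : α (d n (op a • x)) = e n (α (op a • x)) := by rw [hm, h]
    rw [α.map_smul, hd.map_smul, he.map_smul, map_sum, ← sub_eq_zero, ← sum_sub_distrib,
      sum_eq_single (n, 0)] at key
    · simpa [Δ.zero_apply, smul_sub] using key
    · rintro ⟨i, j⟩ hij hne
      have hij' := HasAntidiagonal.mem_antidiagonal.1 hij
      have hi : i < n := by
        rcases Nat.eq_zero_or_pos j with rfl | hj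
        · exact absurd (by simpa using hij') hne
        · simp only at hij'; omega
      rw [α.map_smul, ih i hi, sub_self]
    · intro hn
      simp at hn

end RightGabrielFilter

/-! ### Homomorphisms extended by zero -/

namespace RightGabrielFilter

open Finset

variable {A : Type u} [Ring A] (F : RightGabrielFilter A)
variable {M : Type v} [AddCommGroup M] [Module Aᵐᵒᵖ M]

open Classical in
/-- The extension by zero to `A` of a homomorphism on a right ideal in the filter. -/
noncomputable def extendByZero (i : F.Index) (f : F.HomOn M i) (a : A) : M ⧸ F.torsion M :=
  -- The default value spares membership proofs inside sums. The extension is additive in f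
  -- everywhere, but additivity and linearity in a are used only inside the ideal.
  if h : a ∈ F.idealOf i then f ⟨a, h⟩ else 0

section ExtendByZero

variable {i : F.Index} {f g : F.HomOn M i} {a b : A}

theorem extendByZero_of_mem (h : a ∈ F.idealOf i) : F.extendByZero i f a = f ⟨a, h⟩ := dif_pos h

theorem extendByZero_add (ha : a ∈ F.idealOf i) (hb : b ∈ F.idealOf i) :
    F.extendByZero i f (a + b) = F.extendByZero i f a + F.extendByZero i f b := by
  rw [F.extendByZero_of_mem ha, F.extendByZero_of_mem hb,
    F.extendByZero_of_mem ((F.idealOf i).add_mem ha hb), ← map_add]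
  rfl

theorem extendByZero_mul (ha : a ∈ F.idealOf i) :
    F.extendByZero i f (a * b) = op b • F.extendByZero i f a := by
  have hab : a * b ∈ F.idealOf i := (F.idealOf i).smul_mem (op b) ha
  rw [F.extendByZero_of_mem ha, F.extendByZero_of_mem hab, ← map_smul]
  rfl

theorem extendByZero_zero : F.extendByZero i f 0 = 0 := by
  rw [F.extendByZero_of_mem (F.idealOf i).zero_mem]
  exact map_zero f

theorem extendByZero_sum {ι : Type*} {s : Finset ι} {x : ι → A}
    (hx : ∀ k ∈ s, x k ∈ F.idealOf i) :
    F.extendByZero i f (∑ k ∈ s, x k) = ∑ k ∈ s, F.extendByZero i f (x k) := by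
  classical
  induction s using Finset.induction_on with
  | empty => simpa using F.extendByZero_zero
  | insert k s hk ih =>
    have hs : ∀ l ∈ s, x l ∈ F.idealOf i := fun l hl => hx l (mem_insert_of_mem hl)
    rw [sum_insert hk, sum_insert hk, F.extendByZero_add (hx k (mem_insert_self k s))
      ((F.idealOf i).sum_mem hs), ih hs]

theorem add_extendByZero :
    F.extendByZero i (f + g) a = F.extendByZero i f a + F.extendByZero i g a := by
  unfold extendByZero
  split_ifs
  · rfl
  · rw [add_zero]

theorem extendByZero_restrict {j : F.Index} (h : i ≤ j) (ha : a ∈ F.idealOf j) :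
    F.extendByZero j (F.restrict M i j h f) a = F.extendByZero i f a := by
  rw [F.extendByZero_of_mem ha, F.extendByZero_of_mem (idealOf_le h ha)]
  rfl

end ExtendByZero

variable (M) in
/-- The map `M/t(M) → M_F` induced by the canonical map. -/
noncomputable def quotientToQuotients : (M ⧸ F.torsion M) →ₗ[Aᵐᵒᵖ] F.ModuleOfQuotients M :=
  (F.torsion M).liftQ (F.toQuotients M) fun m hm => by
    refine (congrArg (F.ofHom _) (LinearMap.ext fun a => ?_)).trans (F.ofHom_zero _)
    change op a.1 • (F.torsion M).mkQ m = 0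
    rw [Submodule.mkQ_apply, (Submodule.Quotient.mk_eq_zero _).2 hm, smul_zero]

theorem smul_ofHom_eq_quotientToQuotients (i : F.Index) (f : F.HomOn M i) {a : A}
    (ha : a ∈ F.idealOf i) : op a • F.ofHom i f = F.quotientToQuotients M (f ⟨a, ha⟩) := by
  obtain ⟨m, hm⟩ := (F.torsion M).mkQ_surjective (f ⟨a, ha⟩)
  rw [F.smul_ofHom_of_mem i f ha hm, ← hm]
  rfl

end RightGabrielFilter

/-! ### Extension of a higher derivation to the module of quotients -/

namespace IsRightHigherDerivation

open Finset

variable {A : Type u} [Ring A] {Δ : HigherDerivation A} {M : Type v} [AddCommGroup M]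
  [Module Aᵐᵒᵖ M] {d : ℕ → M →+ M}

/-- Let K annihilate m and d_i(m) for i < n. If δ_0(a), …, δ_n(a) ∈ K, then expanding 0 = d_n(ma)
leaves only d_n(m)a, and by invariance such a form an ideal of the filter. -/
theorem map_mem_torsion (hd : IsRightHigherDerivation Δ d) (F : RightGabrielFilter A) (n : ℕ)
    {m : M} (hm : m ∈ F.torsion M) : d n m ∈ F.torsion M := by
  induction n using Nat.strong_induction_on with
  | _ n ih =>
    have hK := F.inf_mem hm (F.finset_inf_mem (range n) (fun i => rightResidual (d i m) ⊥)
      fun i hi => ih i (mem_range.1 hi))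
    refine F.mem_torsion_of_smul_eq_zero (Δ.comapIdeal_mem F hK n) fun a ha => ?_
    have h := hd.map_smul n m a
    have h0 : op a • m = 0 := (Δ.comapIdeal_le _ n ha).1
    rw [h0, _root_.map_zero, sum_eq_single (n, 0)] at h
    · simpa [Δ.zero_apply] using h.symm
    · rintro ⟨i, j⟩ hij hne
      have hij' := HasAntidiagonal.mem_antidiagonal.1 hij
      have hi : i < n := by
        rcases Nat.eq_zero_or_pos j with rfl | hj
        · exact absurd (by simpa using hij') hne
        · simp only at hij'; omega
      exact Finset.inf_le (f := fun i => rightResidual (d i m) ⊥) (mem_range.2 hi)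
        (ha j (by simp only at hij'; omega)).2
    · intro hn
      simp at hn

/-- The higher derivation induced on the torsion-free quotient. -/
def onQuotient (hd : IsRightHigherDerivation Δ d) (F : RightGabrielFilter A) (n : ℕ) :
    M ⧸ F.torsion M →+ M ⧸ F.torsion M :=
  QuotientAddGroup.map (F.torsion M).toAddSubgroup (F.torsion M).toAddSubgroup (d n)
    fun _ hm => hd.map_mem_torsion F n hm

theorem onQuotient_mkQ (hd : IsRightHigherDerivation Δ d) (F : RightGabrielFilter A) (n : ℕ)
    (m : M) : hd.onQuotient F n ((F.torsion M).mkQ m) = (F.torsion M).mkQ (d n m) := rfl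

theorem onQuotient_isRightHigherDerivation (hd : IsRightHigherDerivation Δ d)
    (F : RightGabrielFilter A) : IsRightHigherDerivation Δ (hd.onQuotient F) where
  map_zero := by
    ext x
    obtain ⟨m, rfl⟩ := (F.torsion M).mkQ_surjective x
    rw [onQuotient_mkQ, hd.map_zero]
    rfl
  map_smul n x a := by
    obtain ⟨m, rfl⟩ := (F.torsion M).mkQ_surjective x
    rw [← _root_.map_smul, onQuotient_mkQ, hd.map_smul, map_sum]
    rfl

/-- The action of the inverse higher derivation cancels in `∑ d_p(x_k ε_l(b))`, `ε = Δ⁻¹`. -/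
theorem sum_map_inv_smul (hd : IsRightHigherDerivation Δ d) (n : ℕ) (x : ℕ → M) (b : A) :
    ∑ p ∈ antidiagonal n, d p.1 (∑ q ∈ antidiagonal p.2, op (Δ.inv.toFun q.2 b) • x q.1) =
      op b • ∑ p ∈ antidiagonal n, d p.1 (x p.2) := by
  simp only [map_sum, hd.map_smul]
  -- After the exchange of indices the coefficients are the convolutions ∑ δ_j(ε_l(b)), which vanish
  -- outside degree 0.
  rw [sum_congr rfl fun p _ => sum_comm,
    sum_antidiagonal_four_comm n fun i j k l => op (Δ.toFun j (Δ.inv.toFun l b)) • d i (x k)]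
  have h : ∀ m, ∑ p ∈ antidiagonal m, op (Δ.toFun p.1 (Δ.inv.toFun p.2 b)) =
      if m = 0 then op b else 0 := fun m => by
    rw [← op_sum, Δ.sum_apply_inv]
    split_ifs <;> simp
  simp only [← sum_smul, h]
  rw [sum_antidiagonal_of_ne_zero_eq_zero n fun i j =>
    ∑ q ∈ antidiagonal i, (if j = 0 then op b else 0) • d q.1 (x q.2), smul_sum]
  · simp
  · intro i j hj
    simp [hj]

variable (hd : IsRightHigherDerivation Δ d) (F : RightGabrielFilter A)

/-- The index on which the `n`-th derivative of a homomorphism with index `i` is defined. -/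
noncomputable abbrev derivIndex (Δ : HigherDerivation A) (F : RightGabrielFilter A) (n : ℕ) (i : F.Index) :
    F.Index :=
  F.index (Δ.inv.comapIdeal (F.idealOf i) n) (Δ.inv.comapIdeal_mem F i.2 n)

/-- The `n`-th derivative `∑ d_i ∘ f ∘ ε_{n-i}` of a homomorphism `f`, where `ε` is the inverse of
the higher derivation of the ring. -/
noncomputable def derivHom (n : ℕ) (i : F.Index) (f : F.HomOn M i) :
    F.HomOn M (derivIndex Δ F n i) where
  toFun a := ∑ p ∈ antidiagonal n,
    hd.onQuotient F p.1 (F.extendByZero i f (Δ.inv.toFun p.2 a.1))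
  map_add' a b := by
    rw [← sum_add_distrib]
    refine sum_congr rfl fun p hp => ?_
    have hp' : p.2 ≤ n := by
      have := HasAntidiagonal.mem_antidiagonal.1 hp
      omega
    change hd.onQuotient F p.1 (F.extendByZero i f (Δ.inv.toFun p.2 (a.1 + b.1))) = _
    rw [map_add, F.extendByZero_add (a.2 p.2 hp') (b.2 p.2 hp'), map_add]
  map_smul' c a := by
    -- The sequence is x_k = f(ε_k(a)): by the Leibniz rule for ε and linearity of f, f(ε_m(ac)) = ∑
    -- x_k · ε_{m-k}(c).
    rw [RingHom.id_apply, ← op_unop c,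
      ← (hd.onQuotient_isRightHigherDerivation F).sum_map_inv_smul n
        (fun k => F.extendByZero i f (Δ.inv.toFun k a.1)) (unop c)]
    refine sum_congr rfl fun p hp => ?_
    change hd.onQuotient F p.1 (F.extendByZero i f (Δ.inv.toFun p.2 (a.1 * unop c))) = _
    have hp' := HasAntidiagonal.mem_antidiagonal.1 hp
    have hq : ∀ q ∈ antidiagonal p.2, Δ.inv.toFun q.1 a.1 ∈ F.idealOf i := fun q hq =>
      a.2 q.1 (by have := HasAntidiagonal.mem_antidiagonal.1 hq; omega)
    rw [Δ.inv.map_mul, F.extendByZero_sum (x := fun q => Δ.inv.toFun q.1 a.1 * Δ.inv.toFun q.2 (unop c))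
      fun q h => (F.idealOf i).smul_mem (op (Δ.inv.toFun q.2 (unop c))) (hq q h)]
    exact congrArg _ (sum_congr rfl fun q h => F.extendByZero_mul (hq q h))

theorem derivHom_apply (n : ℕ) (i : F.Index) (f : F.HomOn M i)
    (a : F.idealOf (derivIndex Δ F n i)) :
    hd.derivHom F n i f a = ∑ p ∈ antidiagonal n,
      hd.onQuotient F p.1 (F.extendByZero i f (Δ.inv.toFun p.2 a.1)) := rfl

/-- The extension of a higher derivation to the module of quotients. -/
noncomputable def onQuotients (n : ℕ) : F.ModuleOfQuotients M →+ F.ModuleOfQuotients M :=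
  AddMonoidHom.mk' (DirectLimit.lift (F.restrict M) (fun i f => F.ofHom _ (hd.derivHom F n i f))
    (fun i j h f => by
      refine F.ofHom_eq_ofHom (derivIndex Δ F n j)
        (RightGabrielFilter.index_le (i := derivIndex Δ F n i) (Δ.inv.comapIdeal_mono h n)) le_rfl
        fun a ha => ?_
      rw [derivHom_apply, derivHom_apply]
      refine sum_congr rfl fun p hp => ?_
      rw [F.extendByZero_restrict]
      exact ha p.2 (by have := HasAntidiagonal.mem_antidiagonal.1 hp; omega)))
    (fun x y => by
      obtain ⟨i, f, g, rfl, rfl⟩ := F.ofHom_surj₂ x y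
      rw [← F.ofHom_add]
      refine (congrArg (F.ofHom _) ?_).trans (F.ofHom_add _ _ _)
      ext a
      rw [LinearMap.add_apply, derivHom_apply, derivHom_apply, derivHom_apply, ← sum_add_distrib]
      exact sum_congr rfl fun p _ => by rw [F.add_extendByZero, map_add])

theorem onQuotients_ofHom (n : ℕ) (i : F.Index) (f : F.HomOn M i) :
    hd.onQuotients F n (F.ofHom i f) = F.ofHom _ (hd.derivHom F n i f) := rfl

theorem onQuotients_toQuotients (n : ℕ) (m : M) :
    hd.onQuotients F n (F.toQuotients M m) = F.toQuotients M (d n m) := by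
  refine F.ofHom_eq_ofHom (derivIndex Δ F n (F.index ⊤ F.top_mem)) le_rfl
    (RightGabrielFilter.index_le (i := F.index ⊤ F.top_mem) fun _ _ => trivial) fun a ha => ?_
  rw [derivHom_apply]
  -- For the sequence concentrated in degree 0 at the class of m, the inner sums are [m] · ε_j(a),
  -- the values of the homomorphism representing q(m).
  have h := (hd.onQuotient_isRightHigherDerivation F).sum_map_inv_smul n
    (fun k => if k = 0 then (F.torsion M).mkQ m else 0) a
  rw [sum_antidiagonal_of_ne_zero_eq_zero n fun i j =>
    hd.onQuotient F i (if j = 0 then (F.torsion M).mkQ m else 0)] at h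
  · refine Eq.trans (sum_congr rfl fun p _ => congrArg _ ?_) (h.trans ?_)
    · rw [sum_antidiagonal_swap p.2 fun i j =>
        op (Δ.inv.toFun j a) • if i = 0 then (F.torsion M).mkQ m else 0,
        sum_antidiagonal_of_ne_zero_eq_zero p.2 fun i j =>
          op (Δ.inv.toFun i a) • if j = 0 then (F.torsion M).mkQ m else 0]
      · rw [if_pos rfl]
        exact F.extendByZero_of_mem (i := F.index ⊤ F.top_mem) (f := F.homOfElem m) trivial
      · intro i j hj
        simp [hj]
    · rw [if_pos rfl, onQuotient_mkQ]
      rfl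
  · intro i j hj
    simp [hj]

/-- If `h s r k = φ(ε_r(δ_k(a)) ε_s(b))`, this regroups the terms of `∑ (d_i φ)(δ_{n-i}(a) b)`. -/
theorem sum_regroup {N : Type*} [AddCommMonoid N] (e : ℕ → N →+ N) (h : ℕ → ℕ → ℕ → N) (n : ℕ) :
    ∑ p ∈ antidiagonal n, ∑ q ∈ antidiagonal p.1, e q.1 (∑ r ∈ antidiagonal q.2, h r.2 r.1 p.2) =
      ∑ p ∈ antidiagonal n, e p.1 (∑ r ∈ antidiagonal p.2, ∑ t ∈ antidiagonal r.2,
        h r.1 t.1 t.2) := by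
  rw [sum_antidiagonal_assoc n fun a b c => e a (∑ r ∈ antidiagonal b, h r.2 r.1 c)]
  refine sum_congr rfl fun p _ => ?_
  rw [← map_sum, ← sum_antidiagonal_assoc p.2 h]
  exact congrArg _ (sum_congr rfl fun q _ => sum_antidiagonal_swap q.1 fun r s => h s r q.2)

/-- By torsion-freeness it suffices to compare the two sides after multiplication by b from an ideal
of the filter. Taking b deep enough makes every argument of f lie in its domain; then both sides
become ∑ d_i(f(a ε_j(b))). -/
theorem onQuotients_smul_ofHom (n : ℕ) (i : F.Index) (f : F.HomOn M i) (a : A) :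
    hd.onQuotients F n (op a • F.ofHom i f) = ∑ p ∈ antidiagonal n,
      op (Δ.toFun p.2 a) • hd.onQuotients F p.1 (F.ofHom i f) := by
  -- L is chosen so that ε_s(b) ∈ L for s ≤ n puts all products ε_r(δ_k(a)) ε_s(b), r, k ≤ n, in the
  -- domain of f.
  let L := (range (n + 1) ×ˢ range (n + 1)).inf fun k =>
    rightResidual (Δ.inv.toFun k.1 (Δ.toFun k.2 a)) (F.idealOf i)
  have hL : L ∈ F.ideals := F.finset_inf_mem _ _ fun k _ => F.residual_mem _ i.2 _
  have hmem : ∀ b ∈ Δ.inv.comapIdeal L n, ∀ r ≤ n, ∀ k ≤ n, ∀ s ≤ n,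
      Δ.inv.toFun r (Δ.toFun k a) * Δ.inv.toFun s b ∈ F.idealOf i := fun b hb r hr k hk s hs => by
    have h := Finset.inf_le (f := fun k : ℕ × ℕ =>
      rightResidual (Δ.inv.toFun k.1 (Δ.toFun k.2 a)) (F.idealOf i)) (b := (r, k))
      (mem_product.2 ⟨mem_range.2 (by simp only; omega), mem_range.2 (by simp only; omega)⟩)
      (hb s hs)
    exact h
  refine sub_eq_zero.1 (F.moduleOfQuotients_eq_zero (Δ.inv.comapIdeal_mem F hL n) fun b hb => ?_)
  have hb' := hmem b hb
  have hmul : ∀ m ≤ n, ∀ k ≤ n, F.extendByZero i f (Δ.inv.toFun m (Δ.toFun k a * b)) =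
      ∑ r ∈ antidiagonal m,
        F.extendByZero i f (Δ.inv.toFun r.1 (Δ.toFun k a) * Δ.inv.toFun r.2 b) :=
    fun m hm k hk => by
      rw [Δ.inv.map_mul, F.extendByZero_sum]
      intro r hr
      have := HasAntidiagonal.mem_antidiagonal.1 hr
      exact hb' r.1 (by omega) k hk r.2 (by omega)
  -- Here ε stands to the left of δ, so the left-inverse identity is the one needed.
  have hcancel : ∀ w ≤ n, ∀ s ≤ n, ∑ t ∈ antidiagonal w,
      F.extendByZero i f (Δ.inv.toFun t.1 (Δ.toFun t.2 a) * Δ.inv.toFun s b) =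
        if w = 0 then F.extendByZero i f (a * Δ.inv.toFun s b) else 0 := fun w hw s hs => by
    rw [← F.extendByZero_sum, ← sum_mul, Δ.sum_inv_apply]
    · split_ifs
      · rfl
      · rw [zero_mul, F.extendByZero_zero]
    · intro t ht
      have := HasAntidiagonal.mem_antidiagonal.1 ht
      exact hb' t.1 (by omega) t.2 (by omega) s hs
  have hleft : b ∈ F.idealOf (derivIndex Δ F n
      (F.index (rightResidual a (F.idealOf i)) (F.residual_mem _ i.2 a))) := fun s hs => by
    have h := hb' 0 (Nat.zero_le n) 0 (Nat.zero_le n) s hs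
    rw [Δ.zero_apply, Δ.inv.zero_apply] at h
    exact h
  have hright : ∀ p ∈ antidiagonal n, Δ.toFun p.2 a * b ∈ F.idealOf (derivIndex Δ F p.1 i) :=
    fun p hp m hm => by
      have hp' := HasAntidiagonal.mem_antidiagonal.1 hp
      rw [Δ.inv.map_mul]
      refine (F.idealOf i).sum_mem fun r hr => ?_
      have := HasAntidiagonal.mem_antidiagonal.1 hr
      exact hb' r.1 (by omega) p.2 (by omega) r.2 (by omega)
  have e₁ : op b • hd.onQuotients F n (op a • F.ofHom i f) = F.quotientToQuotients M
      (∑ p ∈ antidiagonal n, hd.onQuotient F p.1 (F.extendByZero i f (a * Δ.inv.toFun p.2 b))) := by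
    exact F.smul_ofHom_eq_quotientToQuotients _ (hd.derivHom F n _ (F.homSMul a i f)) hleft
  have e₂ : ∀ p ∈ antidiagonal n, op b • op (Δ.toFun p.2 a) • hd.onQuotients F p.1 (F.ofHom i f) =
      F.quotientToQuotients M (∑ q ∈ antidiagonal p.1, hd.onQuotient F q.1
        (∑ r ∈ antidiagonal q.2,
          F.extendByZero i f (Δ.inv.toFun r.1 (Δ.toFun p.2 a) * Δ.inv.toFun r.2 b))) :=
    fun p hp => by
      rw [← mul_smul, ← op_mul, onQuotients_ofHom,
        F.smul_ofHom_eq_quotientToQuotients _ _ (hright p hp), derivHom_apply]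
      refine congrArg _ (sum_congr rfl fun q hq => congrArg _ ?_)
      have := HasAntidiagonal.mem_antidiagonal.1 hp
      have := HasAntidiagonal.mem_antidiagonal.1 hq
      exact hmul q.2 (by omega) p.2 (by omega)
  rw [smul_sub, e₁, smul_sum, sum_congr rfl e₂, ← map_sum, sub_eq_zero,
    sum_regroup (hd.onQuotient F) (fun s r k =>
      F.extendByZero i f (Δ.inv.toFun r (Δ.toFun k a) * Δ.inv.toFun s b))]
  refine congrArg _ (sum_congr rfl fun p hp => congrArg _ ?_)
  have hp' := HasAntidiagonal.mem_antidiagonal.1 hp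
  rw [sum_congr rfl fun r hr => hcancel r.2
    (by have := HasAntidiagonal.mem_antidiagonal.1 hr; omega) r.1
    (by have := HasAntidiagonal.mem_antidiagonal.1 hr; omega),
    sum_antidiagonal_of_ne_zero_eq_zero p.2 fun s w =>
      if w = 0 then F.extendByZero i f (a * Δ.inv.toFun s b) else 0, if_pos rfl]
  intro s w hw
  simp [hw]

theorem onQuotients_isRightHigherDerivation :
    IsRightHigherDerivation Δ (hd.onQuotients F) where
  map_zero := by
    ext x
    obtain ⟨i, f, rfl⟩ := F.ofHom_surj x
    refine F.ofHom_eq_ofHom (derivIndex Δ F 0 i) le_rfl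
      (RightGabrielFilter.index_le (Δ.inv.comapIdeal_le _ 0)) fun a ha => ?_
    rw [derivHom_apply]
    have hN := (hd.onQuotient_isRightHigherDerivation F).map_zero
    simp only [HasAntidiagonal.antidiagonal_zero, sum_singleton, hN, Δ.inv.zero_apply, AddMonoidHom.id_apply]
    exact F.extendByZero_of_mem (Δ.inv.comapIdeal_le _ 0 ha)
  map_smul n x a := by
    obtain ⟨i, f, rfl⟩ := F.ofHom_surj x
    exact hd.onQuotients_smul_ofHom F n i f a

end IsRightHigherDerivation

/-! ### The induced higher derivation on R ⊗ R^op -/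

namespace HigherDerivation

open Finset

variable {R : Type u} [Ring R] (Δ : HigherDerivation R)

theorem env_zero : Δ.env 0 = AddMonoidHom.id (Env R) := by
  ext x
  induction x using TensorProduct.induction_on with
  | zero => rw [_root_.map_zero, _root_.map_zero]
  | add x y hx hy => rw [map_add, map_add, hx, hy]
  | tmul r s =>
    rw [← op_unop s, env_tmul]
    simp [Δ.zero_apply]

/-- All terms but one contain δ_j(1) = 0 with j > 0. With its left-hand analogue, this turns the
Leibniz rule over R ⊗ R^op back into the two rules over R. -/
theorem env_tmul_one (n : ℕ) (r : R) :
    Δ.env n (r ⊗ₜ[ℤ] (1 : Rᵐᵒᵖ)) = Δ.toFun n r ⊗ₜ[ℤ] (1 : Rᵐᵒᵖ) := by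
  rw [← op_one, env_tmul, sum_antidiagonal_of_ne_zero_eq_zero n fun i j =>
    Δ.toFun i r ⊗ₜ[ℤ] op (Δ.toFun j 1)]
  · rw [Δ.zero_apply]
  · intro i j hj
    rw [Δ.map_one j hj, op_zero, TensorProduct.tmul_zero]

theorem env_one_tmul (n : ℕ) (s : R) :
    Δ.env n ((1 : R) ⊗ₜ[ℤ] op s) = (1 : R) ⊗ₜ[ℤ] op (Δ.toFun n s) := by
  rw [env_tmul, sum_antidiagonal_swap n fun i j => Δ.toFun i 1 ⊗ₜ[ℤ] op (Δ.toFun j s),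
    sum_antidiagonal_of_ne_zero_eq_zero n fun i j => Δ.toFun j 1 ⊗ₜ[ℤ] op (Δ.toFun i s)]
  · rw [Δ.zero_apply]
  · intro i j hj
    rw [Δ.map_one j hj, TensorProduct.zero_tmul]

/-- The Leibniz rule over `R ⊗ R^op` follows from the Leibniz rules over `R` on both sides. -/
theorem env_leibniz {M : Type v} [AddCommGroup M] [Module (Env R)ᵐᵒᵖ M] (d : ℕ → M →+ M)
    (hl : ∀ n (s : R) (m : M), d n (op ((1 : R) ⊗ₜ[ℤ] op s) • m) =
      ∑ p ∈ antidiagonal n, op ((1 : R) ⊗ₜ[ℤ] op (Δ.toFun p.1 s)) • d p.2 m)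
    (hr : ∀ n (m : M) (r : R), d n (op (r ⊗ₜ[ℤ] (1 : Rᵐᵒᵖ)) • m) =
      ∑ p ∈ antidiagonal n, op (Δ.toFun p.2 r ⊗ₜ[ℤ] (1 : Rᵐᵒᵖ)) • d p.1 m)
    (n : ℕ) (m : M) (x : Env R) :
    d n (op x • m) = ∑ p ∈ antidiagonal n, op (Δ.env p.2 x) • d p.1 m := by
  -- The action of r ⊗ s is the right action of r followed by the left action of s, so the one-sided
  -- rules compose.
  have hmul : ∀ (r s : R) (m : M), op (r ⊗ₜ[ℤ] op s) • m =
      op ((1 : R) ⊗ₜ[ℤ] op s) • op (r ⊗ₜ[ℤ] (1 : Rᵐᵒᵖ)) • m := fun r s m => by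
    rw [← mul_smul, ← op_mul, Algebra.TensorProduct.tmul_mul_tmul, mul_one, one_mul]
  induction x using TensorProduct.induction_on with
  | zero =>
    have h0 : ∀ m : M, op (0 : Env R) • m = 0 := fun m => zero_smul (Env R)ᵐᵒᵖ m
    simp only [_root_.map_zero, h0, sum_const_zero]
  | add x y hx hy => simp only [op_add, add_smul, map_add, hx, hy, sum_add_distrib]
  | tmul r s =>
    obtain ⟨s, rfl⟩ := op_surjective s
    rw [hmul, hl]
    simp only [hr, smul_sum, ← hmul, env_tmul, op_sum, sum_smul]
    rw [sum_antidiagonal_left_comm n fun i j k =>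
      op (Δ.toFun k r ⊗ₜ[ℤ] op (Δ.toFun i s)) • d j m]
    exact sum_congr rfl fun p _ => sum_antidiagonal_swap p.2 fun i k =>
      op (Δ.toFun k r ⊗ₜ[ℤ] op (Δ.toFun i s)) • d p.1 m

theorem env_mul_one_tmul (n : ℕ) (s : R) (x : Env R) : Δ.env n (x * (1 : R) ⊗ₜ[ℤ] op s) =
    ∑ p ∈ antidiagonal n, Δ.env p.2 x * (1 : R) ⊗ₜ[ℤ] op (Δ.toFun p.1 s) := by
  induction x using TensorProduct.induction_on with
  | zero => simp
  | add x y hx hy => simp only [add_mul, map_add, hx, hy, sum_add_distrib]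
  | tmul a b =>
    obtain ⟨b, rfl⟩ := op_surjective b
    simp only [Algebra.TensorProduct.tmul_mul_tmul, ← op_mul, mul_one, env_tmul, Δ.map_mul, op_sum,
      tmul_sum, sum_mul]
    exact sum_antidiagonal_left_comm n fun i j k =>
      Δ.toFun i a ⊗ₜ[ℤ] op (Δ.toFun j s * Δ.toFun k b)

theorem env_mul_tmul_one (n : ℕ) (x : Env R) (r : R) : Δ.env n (x * r ⊗ₜ[ℤ] (1 : Rᵐᵒᵖ)) =
    ∑ p ∈ antidiagonal n, Δ.env p.1 x * Δ.toFun p.2 r ⊗ₜ[ℤ] (1 : Rᵐᵒᵖ) := by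
  induction x using TensorProduct.induction_on with
  | zero => simp
  | add x y hx hy => simp only [add_mul, map_add, hx, hy, sum_add_distrib]
  | tmul a b =>
    obtain ⟨b, rfl⟩ := op_surjective b
    simp only [Algebra.TensorProduct.tmul_mul_tmul, mul_one, env_tmul, Δ.map_mul, sum_tmul, sum_mul]
    rw [sum_antidiagonal_assoc n fun i j k => (Δ.toFun i a * Δ.toFun j r) ⊗ₜ[ℤ] op (Δ.toFun k b),
      sum_antidiagonal_assoc n fun i j k => (Δ.toFun i a * Δ.toFun k r) ⊗ₜ[ℤ] op (Δ.toFun j b)]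
    exact sum_congr rfl fun p _ => sum_antidiagonal_swap p.2 fun j k =>
      (Δ.toFun p.1 a * Δ.toFun j r) ⊗ₜ[ℤ] op (Δ.toFun k b)

/-- The higher derivation of `R ⊗ R^op` induced by a higher derivation of `R`. -/
noncomputable def envHigherDerivation : HigherDerivation (Env R) where
  toFun := Δ.env
  map_zero := Δ.env_zero
  -- Multiplicativity is the Leibniz rule for δ̄ on the regular right module R ⊗ R^op.
  map_mul n x y := Δ.env_leibniz Δ.env (fun n s m => Δ.env_mul_one_tmul n s m)
    (fun n m r => Δ.env_mul_tmul_one n m r) n x y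

end HigherDerivation

theorem symmetricFilter_isInvariant {R : Type u} [Ring R] (Fl : LeftGabrielFilter R)
    (Fr : RightGabrielFilter R) (Δ : HigherDerivation R) : (symmetricFilter Fl Fr).IsInvariant Δ :=
  fun K hK n => ⟨Δ.envHigherDerivation.comapIdeal K n,
    Δ.envHigherDerivation.comapIdeal_mem _ hK n, fun i hi _ hx => hx i hi⟩

/-! ### Extensions to symmetric modules of quotients -/

namespace BimoduleHigherDerivation

variable {R : Type u} [Ring R] {Δ : HigherDerivation R}

theorem ext_toFun {M : Type v} [AddCommGroup M] [Module R M] [Module Rᵐᵒᵖ M]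
    {D D' : BimoduleHigherDerivation Δ M} (h : ∀ n x, D.toFun n x = D'.toFun n x) :
    D = D' := by
  cases D
  cases D'
  congr
  funext n
  exact AddMonoidHom.ext (h n)

variable {M : Type v} [AddCommGroup M] [Module R M] [Module Rᵐᵒᵖ M] [SMulCommClass R Rᵐᵒᵖ M]
  {Fl : LeftGabrielFilter R} {Fr : RightGabrielFilter R}

/-- A higher derivation on a bimodule is one on the corresponding right `R ⊗ R^op`-module. -/
theorem isRightHigherDerivation (D : BimoduleHigherDerivation Δ M) :
    @IsRightHigherDerivation (Env R) _ Δ.envHigherDerivation M _ (bimoduleToRight R M) D.toFun := by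
  let := bimoduleToRight R M
  have h1 : ∀ (s : R) (m : M), op ((1 : R) ⊗ₜ[ℤ] op s) • m = s • m := fun s m => by
    change envAction R M _ m = _
    rw [envAction_tmul, op_one, one_smul]
  have h2 : ∀ (r : R) (m : M), op (r ⊗ₜ[ℤ] (1 : Rᵐᵒᵖ)) • m = op r • m := fun r m => by
    change envAction R M _ m = _
    rw [← op_one, envAction_tmul, one_smul]
  refine ⟨D.map_zero, Δ.env_leibniz D.toFun ?_ ?_⟩
  · intro n s m
    simp only [h1, D.map_smul_left]
  · intro n m r
    simp only [h2, D.map_smul_right]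

/-- Both R-actions on the symmetric module of quotients are defined through R ⊗ R^op, so the two
one-sided rules are already the hypotheses of `env_leibniz`. -/
theorem isRightHigherDerivation_quotients
    (D : BimoduleHigherDerivation Δ (SymmetricQuotients Fl Fr M)) :
    IsRightHigherDerivation Δ.envHigherDerivation D.toFun :=
  ⟨D.map_zero, Δ.env_leibniz D.toFun D.map_smul_left D.map_smul_right⟩

/-- A higher derivation on the symmetric module of quotients over `R ⊗ R^op` is one over `R`. -/
def ofIsRightHigherDerivation
    {d : ℕ → SymmetricQuotients Fl Fr M →+ SymmetricQuotients Fl Fr M}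
    (hd : IsRightHigherDerivation Δ.envHigherDerivation d) :
    BimoduleHigherDerivation Δ (SymmetricQuotients Fl Fr M) where
  toFun := d
  map_zero := hd.map_zero
  map_smul_left n r x := by
    refine (hd.map_smul n x ((1 : R) ⊗ₜ[ℤ] op r)).trans ?_
    rw [sum_antidiagonal_swap n fun i j =>
      op (Δ.envHigherDerivation.toFun j ((1 : R) ⊗ₜ[ℤ] op r)) • d i x]
    refine Finset.sum_congr rfl fun p _ => ?_
    exact congrArg (fun y => op y • d p.2 x) (Δ.env_one_tmul p.1 r)
  map_smul_right n x r := by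
    refine (hd.map_smul n x (r ⊗ₜ[ℤ] (1 : Rᵐᵒᵖ))).trans (Finset.sum_congr rfl fun p _ => ?_)
    exact congrArg (fun y => op y • d p.1 x) (Δ.env_tmul_one p.2 r)

theorem exists_isExtension (Fl : LeftGabrielFilter R) (Fr : RightGabrielFilter R)
    (D : BimoduleHigherDerivation Δ M) :
    ∃ D' : BimoduleHigherDerivation Δ (SymmetricQuotients Fl Fr M), D'.IsExtension D := by
  let := bimoduleToRight R M
  exact ⟨ofIsRightHigherDerivation
    (D.isRightHigherDerivation.onQuotients_isRightHigherDerivation (symmetricFilter Fl Fr)),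
    D.isRightHigherDerivation.onQuotients_toQuotients (symmetricFilter Fl Fr)⟩

theorem IsExtension.unique {D : BimoduleHigherDerivation Δ M}
    {D₁ D₂ : BimoduleHigherDerivation Δ (SymmetricQuotients Fl Fr M)} (h₁ : D₁.IsExtension D)
    (h₂ : D₂.IsExtension D) : D₁ = D₂ := by
  let := bimoduleToRight R M
  refine ext_toFun fun n x => ?_
  -- Uniqueness is the comparison of two higher derivations along the identity.
  exact (symmetricFilter Fl Fr).compatible_of_compatible_on_range
    (fun I hI y => (symmetricFilter Fl Fr).moduleOfQuotients_eq_zero hI) LinearMap.id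
    D₁.isRightHigherDerivation_quotients D₂.isRightHigherDerivation_quotients
    (fun n m => (h₁ n m).trans (h₂ n m).symm) n x

theorem IsExtension.extensionsAgree {Fl' : LeftGabrielFilter R} {Fr' : RightGabrielFilter R}
    (h : (symmetricFilter Fl Fr).ideals ⊆ (symmetricFilter Fl' Fr').ideals)
    {D : BimoduleHigherDerivation Δ M}
    {D₁ : BimoduleHigherDerivation Δ (SymmetricQuotients Fl Fr M)}
    {D₂ : BimoduleHigherDerivation Δ (SymmetricQuotients Fl' Fr' M)} (h₁ : D₁.IsExtension D)
    (h₂ : D₂.IsExtension D) : ExtensionsAgree h D D₁ D₂ := by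
  let := bimoduleToRight R M
  have triangle : ∀ m : M, symmetricQuotientsMap M h (toSymmetricQuotients Fl Fr M m) =
      toSymmetricQuotients Fl' Fr' M m := fun m => rfl
  refine ⟨triangle, h₁, h₂, fun n x => ?_⟩
  exact (symmetricFilter Fl Fr).compatible_of_compatible_on_range
    -- The quotients for the larger filter are torsion-free for the smaller one as well, so the
    -- comparison applies along q₁₂.
    (fun I hI y => (symmetricFilter Fl' Fr').moduleOfQuotients_eq_zero (h hI))
    (RightGabrielFilter.quotientsMap M h)
    D₁.isRightHigherDerivation_quotients D₂.isRightHigherDerivation_quotients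
    (fun n m => (congrArg (symmetricQuotientsMap M h) (h₁ n m)).trans
      ((triangle _).trans ((h₂ n m).symm.trans (congrArg (D₂.toFun n) (triangle m).symm)))) n x

end BimoduleHigherDerivation

theorem mainTheorem5 {R : Type u} [Ring R] :
    -- every symmetric Gabriel filter is higher derivation invariant
    (∀ (Fl : LeftGabrielFilter R) (Fr : RightGabrielFilter R) (Δ : HigherDerivation R),
      (symmetricFilter Fl Fr).IsInvariant Δ) ∧
    -- every `Δ`-higher derivation on a bimodule extends uniquely
    (∀ (Fl : LeftGabrielFilter R) (Fr : RightGabrielFilter R) (Δ : HigherDerivation R)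
      (M : Type v) [AddCommGroup M] [Module R M] [Module Rᵐᵒᵖ M] [SMulCommClass R Rᵐᵒᵖ M]
      (D : BimoduleHigherDerivation Δ M),
      ∃! D' : BimoduleHigherDerivation Δ (SymmetricQuotients Fl Fr M), D'.IsExtension D) ∧
    -- for nested symmetric filters the extensions agree
    (∀ (Fl₁ Fl₂ : LeftGabrielFilter R) (Fr₁ Fr₂ : RightGabrielFilter R)
      (h : (symmetricFilter Fl₁ Fr₁).ideals ⊆ (symmetricFilter Fl₂ Fr₂).ideals)
      (Δ : HigherDerivation R)
      (M : Type v) [AddCommGroup M] [Module R M] [Module Rᵐᵒᵖ M] [SMulCommClass R Rᵐᵒᵖ M]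
      (D : BimoduleHigherDerivation Δ M)
      (D₁ : BimoduleHigherDerivation Δ (SymmetricQuotients Fl₁ Fr₁ M))
      (D₂ : BimoduleHigherDerivation Δ (SymmetricQuotients Fl₂ Fr₂ M)),
      D₁.IsExtension D → D₂.IsExtension D →
        BimoduleHigherDerivation.ExtensionsAgree h D D₁ D₂) :=
  ⟨symmetricFilter_isInvariant,
    fun Fl Fr _ _ _ _ _ _ D =>
      let ⟨D', h⟩ := D.exists_isExtension Fl Fr
      ⟨D', h, fun _ h' => h'.unique h⟩,
    fun _ _ _ _ h _ _ _ _ _ _ _ _ _ h₁ h₂ => h₁.extensionsAgree h h₂⟩
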